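/- \textbf{Setting.} Let $T$ be a complete first-order theory in a vocabulary consisting of relation symbols only, let $P$ be a unary predicate of the vocabulary, and assume that $T$ has quantifier elimination and implies that $P$ is infinite. Assume also that $P$ is stably embedded (in every model $M$ of $T$, each subset of a power of $P^M$ that is definable with parameters is definable with parameters from $P^M$) and that each subset of a power of $P^M$ that is $\emptyset$-definable in $M$ is $\emptyset$-definable in the substructure with universe $P^M$. All sets are subsets of models of $T$, truth of formulas and types are computed in these models or in their elementary extensions, and for a set $A$ in a model $N$ we write $P^A=A\cap P^N$; $A$ also denotes the substructure with universe $A$. \textbf{Definitions.} A set $A$ is \emph{complete} if for every formula $\psi(\bar x,\bar y)$ and every tuple $\bar b$ in $A$, if $(\exists \bar x\in P)\,\psi(\bar x,\bar b)$ holds then $\psi(\bar a,\bar b)$ holds for some tuple $\bar a$ in $P^A$. Let $S_*(A)$ be the set of all types $\mathrm{tp}(\bar c/A)$, where $\bar c$ is a finite tuple in an elementary extension, such that $P\cap (A\cup\bar c)=P\cap A$ and $A\cup\bar c$ is complete. A complete set $A$ is \emph{stable over $P$} if $|S_*(A')|\le |A'|^{|T|}$ for every set $A'$ in a model of $T$ such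 that $A'$ and $A$ are elementarily equivalent as substructures; here $|T|$ is the number of formulas of the vocabulary. A type $p(\bar x)$ over a set $B$ is \emph{locally isolated} if for every formula $\varphi(\bar x,\bar y)$ there is a formula $\theta\in p$ that implies (modulo the elementary diagram of the ambient model) every formula in $p$ of the form $\varphi(\bar x,\bar b)$ or $\neg\varphi(\bar x,\bar b)$ with $\bar b$ a tuple in $B$. A model $M$ is \emph{locally constructible} over a set $A$ with $P^M\subseteq A\subseteq M$ if $M=A\cup\{d_i : i<\alpha\}$ for some ordinal $\alpha$ and elements $d_i$ such that for each $i<\alpha$ the type $\mathrm{tp}(d_i/A\cup\{d_j : j<i\})$ is locally isolated. \textbf{Lemma.} Let $T$ be countable and let $A$ be a countable set, in a model $N$ of $T$, that is stable over $P$. Then $A$ has the locally constructible existence property: in some elementary extension of $N$ there is an elementary submodel $M\supseteq A$ with $P^M=P^A$ such that $M$ is locally constructible over $A$. -/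

import Mathlib

open FirstOrder FirstOrder.Language Cardinal

universe u v w

namespace OverP

variable {L : FirstOrder.Language.{u, v}}

/-- The interpretation `P^M` of the distinguished unary predicate `P` in `M`. -/
def predSet (P : L.Relations 1) (M : Type w) [L.Structure M] : Set M :=
  {x | Structure.RelMap P ![x]}

/-- In a relational language every set `A` is the universe of a substructure. -/
def setSub [L.IsRelational] {M : Type w} [L.Structure M] (A : Set M) : L.Substructure M where
  carrier := A
  fun_mem := fun f => isEmptyElim f

/-- `T` has quantifier elimination. -/
def HasQE (T : L.Theory) : Prop :=
  ∀ (n : ℕ) (φ : L.Formula (Fin n)), ∃ ψ : L.Formula (Fin n),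
    BoundedFormula.IsQF ψ ∧ T ⊨ᵇ BoundedFormula.iff φ ψ

/-- `T` implies that `P` is infinite. -/
def PredInfinite (T : L.Theory) (P : L.Relations 1) : Prop :=
  ∀ M : Theory.ModelType.{u, v, max u v} T, (predSet P M).Infinite

/-- `P` is stably embedded: in every model of `T`, every subset of a power of `P` that is definable
with parameters is definable with parameters from `P`. -/
def StablyEmbedded (T : L.Theory) (P : L.Relations 1) : Prop :=
  ∀ (M : Theory.ModelType.{u, v, max u v} T) (n : ℕ) (D : Set (Fin n → M)),
    (∀ x ∈ D, ∀ i, x i ∈ predSet P M) →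
    (Set.univ : Set M).Definable L D → (predSet P M).Definable L D

/-- Every subset of a power of `P` that is definable without parameters in a model `M` of `T` is
definable without parameters in the substructure of `M` with universe `P^M`. -/
def DefinableInPred [L.IsRelational] (T : L.Theory) (P : L.Relations 1) : Prop :=
  ∀ (M : Theory.ModelType.{u, v, max u v} T) (n : ℕ)
    (D : Set (Fin n → setSub (L := L) (predSet P M))),
    (∅ : Set M).Definable L ((fun x : Fin n → setSub (L := L) (predSet P M) =>
      fun i => (x i : M)) '' D) →
    (∅ : Set (setSub (L := L) (predSet P M))).Definable L D

section Sets

variable {M : Type w} [L.Structure M]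

/-- `A` is a complete set: whenever `b` is a tuple in `A` and `(∃ x ∈ P) ψ(x, b)` holds in the
ambient model, then `ψ(a, b)` holds for some tuple `a` in `P ∩ A`. -/
def IsCompleteSet (P : L.Relations 1) (A : Set M) : Prop :=
  ∀ (m n : ℕ) (ψ : L.Formula (Fin m ⊕ Fin n)) (b : Fin n → M), (∀ i, b i ∈ A) →
    (∃ a : Fin m → M, (∀ i, a i ∈ predSet P M) ∧ ψ.Realize (Sum.elim a b)) →
    ∃ a : Fin m → M, (∀ i, a i ∈ predSet P M ∩ A) ∧ ψ.Realize (Sum.elim a b)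

/-- The complete type of the tuple `c` over the family of parameters `a`: a formula over the
parameters is an `L`-formula whose variables are the parameters and `x_0, …, x_{n-1}`. -/
def tp {α : Type w} (a : α → M) {n : ℕ} (c : Fin n → M) : Set (L.Formula (α ⊕ Fin n)) :=
  {φ | φ.Realize (Sum.elim a c)}

/-- The formula `φ(x, b)` over `A`, for `φ(x, y)` a formula and `b` a tuple in `A`. -/
def inst {A : Set M} {n m : ℕ} (φ : L.Formula (Fin n ⊕ Fin m)) (b : Fin m → A) :
    L.Formula (A ⊕ Fin n) :=
  φ.relabel (Sum.elim Sum.inr (fun i => Sum.inl (b i)))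

/-- The restriction of `p` to a `φ`-type: all `φ(x, b)` and `¬ φ(x, b)` in `p`. -/
def restrictTo {A : Set M} {n m : ℕ} (p : Set (L.Formula (A ⊕ Fin n)))
    (φ : L.Formula (Fin n ⊕ Fin m)) : Set (L.Formula (A ⊕ Fin n)) :=
  {χ | χ ∈ p ∧ ∃ b : Fin m → A, χ = inst φ b ∨ χ = (inst φ b).not}

/-- The formula `θ` over `A` implies the set `q` of formulas over `A` (modulo the elementary
diagram of the ambient model). -/
def Implies {A : Set M} {n : ℕ} (θ : L.Formula (A ⊕ Fin n)) (q : Set (L.Formula (A ⊕ Fin n))) :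
    Prop :=
  ∀ x : Fin n → M, θ.Realize (Sum.elim (Subtype.val : A → M) x) →
    ∀ χ ∈ q, χ.Realize (Sum.elim (Subtype.val : A → M) x)

/-- `p` is locally isolated: for every `φ(x, y)` some formula of `p` implies the restriction of `p`
to a `φ`-type. -/
def LocallyIsolated {A : Set M} {n : ℕ} (p : Set (L.Formula (A ⊕ Fin n))) : Prop :=
  ∀ (m : ℕ) (φ : L.Formula (Fin n ⊕ Fin m)), ∃ θ ∈ p, Implies θ (restrictTo p φ)

/-- The sequence `⟨d i : i < α⟩` is a local construction over `B`: for every `i < α` the type of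
`d i` over `B ∪ {d j : j < i}` is locally isolated. -/
def IsLocalConstruction (L : FirstOrder.Language.{u, v}) {M : Type w} [L.Structure M] (B : Set M)
    {α : Ordinal.{w}} (d : Set.Iio α → M) : Prop :=
  ∀ i : Set.Iio α, LocallyIsolated
    (tp (L := L) (Subtype.val : ↥(B ∪ d '' Set.Iio i) → M) (fun _ : Fin 1 => d i))

/-- The subset `C` of the model `M` is locally constructible over `B` in `M`: `P^M ⊆ B` and
`C = B ∪ {d i : i < α}` for a local construction `⟨d i : i < α⟩` over `B`. -/
def LocallyConstructible (P : L.Relations 1) (B C : Set M) : Prop :=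
  predSet P M ⊆ B ∧
    ∃ (α : Ordinal.{w}) (d : Set.Iio α → M), IsLocalConstruction L B d ∧ C = B ∪ Set.range d

/-- `S_*(A)` for `n`-tuples: the complete types `tp(c/A)`, with `c` an `n`-tuple in an elementary
extension `N` of the ambient model `M`, such that `P ∩ (A ∪ c) = P ∩ A` and `A ∪ c` is complete. -/
def SStar (P : L.Relations 1) (A : Set M) (n : ℕ) : Set (Set (L.Formula (A ⊕ Fin n))) :=
  {p | ∃ (N : Type w) (_ : L.Structure N) (j : M ↪ₑ[L] N) (c : Fin n → N),
    predSet P N ∩ (j '' A ∪ Set.range c) = predSet P N ∩ j '' A ∧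
    IsCompleteSet P (j '' A ∪ Set.range c) ∧
    p = tp (fun a : A => j a) c}

end Sets

/-- `|T|`: the number of formulas of the language of `T`. -/
noncomputable def theoryCard (L : FirstOrder.Language.{u, v}) : Cardinal.{max u v} := max ℵ₀ L.card

/-- The set `A` (in a model of `T`) is stable over `P`: it is complete, and
`|S_*(A')| ≤ |A'| ^ |T|` for all sets `A'` in models of `T` such that `A'` and `A` are elementarily
equivalent as substructures. Here `S_*(A')` consists of types of tuples of all finite lengths. -/
def StableOver [L.IsRelational] (T : L.Theory) (P : L.Relations 1) {M : Type (max u v)}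
    [L.Structure M] (A : Set M) : Prop :=
  IsCompleteSet P A ∧
    ∀ (M' : Theory.ModelType.{u, v, max u v} T) (A' : Set M'),
      (setSub (L := L) A') ≅[L] (setSub (L := L) A) →
      #(Σ n : ℕ, SStar P A' n) ≤ #A' ^ theoryCard L

/-- The set `A` in the model `N` has the locally constructible existence property: in some
elementary extension `C` of `N` there is an elementary submodel `M` with `A ⊆ M` and
`P^M = P^A` that is locally constructible over `A`. -/
def HasLCExistence (P : L.Relations 1) {N : Type w} [L.Structure N] (A : Set N) : Prop :=
  ∃ (C : Type w) (_ : L.Structure C) (j : N ↪ₑ[L] C) (M : L.ElementarySubstructure C),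
    j '' A ⊆ (M : Set C) ∧
    predSet P C ∩ (M : Set C) = predSet P C ∩ j '' A ∧
    LocallyConstructible P ((Subtype.val : M → C) ⁻¹' (j '' A)) (Set.univ : Set M)

end OverP

/-! The heart is a density statement. Let B = A ∪ d be complete, with d a finite tuple and P ∩ B ⊆
A. Then every nonempty B-definable set contains a nonempty B-definable set on which each instance of
a given φ over A is constant (`StableOver.exists_subset_forall_realize_iff`). If not, every nonempty
B-definable subset of some X is split by an instance of φ over A, and repeated splitting yields
binary trees of instances. Completeness of B allows the definable sets to be shrunk meanwhile, until
finitely many existential statements over P have fixed witnesses in A (`exists_subset_met`,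
`exists_finite_tree`). An ultrapower glues these finite approximations into a tree of height Λ, the
least cardinal with 2^Λ > 2^ℵ₀. Parameters, witnesses and Skolem values form a set A' ≡ A of size at
most 2^ℵ₀, and the branches give 2^Λ distinct types in S_*(A'). Stability allows only (2^ℵ₀)^ℵ₀ =
2^ℵ₀.

Absorbing d into the object variables extends the density from instances over A to instances over B
(`StableOver.exists_subset_decides`). In a countably saturated model, a decreasing sequence of
definable sets that handles the countably many φ then gives, in every nonempty B-definable set, an
element with locally isolated type over B. Adding it to B preserves completeness and adds nothing to
P (`LocallyDetermined.isCompleteSet_insert`, `LocallyDetermined.mem_of_mem_predSet`). Since A and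
the language are countable, ω such steps meet all Tarski–Vaught demands, and before each step only
finitely many elements have been added, so density applies. -/

namespace OverP

/-! ### Definability with parameters, and completeness for definable sets -/

section Definability

variable {L : FirstOrder.Language.{u, v}} {N : Type w} [L.Structure N]

theorem definable_setOf_realize {B : Set N} {β γ : Type*} (ψ : L.Formula γ)
    (f : (β → N) → γ → N)
    (hf : ∀ c, (∃ b ∈ B, ∀ e, f e c = b) ∨ ∃ j, ∀ e, f e c = e j) :
    B.Definable L {e : β → N | ψ.Realize (f e)} := by
  have hg : ∀ c, ∃ g : B ⊕ β, ∀ e, f e c = Sum.elim (Subtype.val : B → N) e g := fun c =>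
    (hf c).elim (fun ⟨b, hb, h⟩ => ⟨Sum.inl ⟨b, hb⟩, h⟩) fun ⟨j, h⟩ => ⟨Sum.inr j, h⟩
  choose g hg using hg
  rw [Set.definable_iff_exists_formula_sum]
  refine ⟨ψ.relabel g, ?_⟩
  ext e
  simp only [Set.mem_ofPred_eq, Formula.realize_relabel]
  exact iff_of_eq (congrArg _ (funext fun c => hg c e))

/-- A set definable with parameters is defined by a formula with finitely many parameters. -/
theorem exists_formula_fin_of_definable {B : Set N} {β : Type*} {D : Set (β → N)}
    (hD : B.Definable L D) : ∃ (n : ℕ) (ψ : L.Formula (β ⊕ Fin n)) (b : Fin n → N),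
      (∀ i, b i ∈ B) ∧ D = {e | ψ.Realize (Sum.elim e b)} := by
  classical
  obtain ⟨φ, rfl⟩ := Set.definable_iff_exists_formula_sum.1 hD
  let s : Finset B := φ.freeVarFinset.preimage Sum.inl Sum.inl_injective.injOn
  refine ⟨s.card, φ.restrictFreeVar fun x => match x with
    | ⟨Sum.inl b, hb⟩ => Sum.inr (s.equivFin ⟨b, Finset.mem_preimage.2 hb⟩)
    | ⟨Sum.inr j, _⟩ => Sum.inl j, fun i => ((s.equivFin.symm i : B) : N),
    fun i => (s.equivFin.symm i : B).2, ?_⟩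
  ext e
  simp only [Set.mem_ofPred_eq]
  refine (BoundedFormula.realize_restrictFreeVar _ ?_).symm
  rintro ⟨b | j, h⟩ <;> simp

theorem IsCompleteSet.exists_mem_of_definable {P : L.Relations 1} {B : Set N}
    (hB : IsCompleteSet P B) {p : ℕ} {D : Set (Fin p → N)} (hD : B.Definable L D)
    {a : Fin p → N} (ha : ∀ i, a i ∈ predSet P N) (haD : a ∈ D) :
    ∃ a : Fin p → N, (∀ i, a i ∈ predSet P N ∩ B) ∧ a ∈ D := by
  obtain ⟨n, ψ, b, hb, rfl⟩ := exists_formula_fin_of_definable hD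
  exact hB p n ψ b hb ⟨a, ha, haD⟩

end Definability

/-! ### Fixing witnesses in P by shrinking a definable set -/

section Requirements

variable {L : FirstOrder.Language.{u, v}} {N : Type w} [L.Structure N]

/-- A requirement `(∃ z ∈ P) ψ(z, y, x)` on a `t`-tuple `x`, with `y` a tuple of parameters. -/
abbrev Req (L : FirstOrder.Language.{u, v}) (t : ℕ) : Type (max u v) :=
  Σ (p : ℕ) (r : ℕ), L.Formula (Fin p ⊕ (Fin r ⊕ Fin t))

/-- The tuple `a` in `P` witnesses the requirement `q` for `e` with parameters `b`, if the
requirement has a witness at all. -/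
def Req.Met (P : L.Relations 1) {t : ℕ} (q : Req L t) (b : Fin q.2.1 → N) (e : Fin t → N)
    (a : Fin q.1 → N) : Prop :=
  (∃ z : Fin q.1 → N, (∀ i, z i ∈ predSet P N) ∧ q.2.2.Realize (Sum.elim z (Sum.elim b e))) →
    (∀ i, a i ∈ predSet P N) ∧ q.2.2.Realize (Sum.elim a (Sum.elim b e))

/-- Every nonempty definable set over a complete set has a nonempty definable subset on which
finitely many requirements are met by fixed witnesses. -/
theorem exists_subset_met {P : L.Relations 1} {A B : Set N} (hB : IsCompleteSet P B)
    (hAB : A ⊆ B) (hPA : predSet P N ∩ B ⊆ A) (hA : A.Nonempty) {t : ℕ}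
    (R : Finset (Σ q : Req L t, Fin q.2.1 → A)) {X : Set (Fin t → N)} (hX : X.Nonempty)
    (hXB : B.Definable L X) :
    ∃ Y ⊆ X, Y.Nonempty ∧ B.Definable L Y ∧
      ∀ ρ ∈ R, ∃ a : Fin ρ.1.1 → A, ∀ e ∈ Y,
        ρ.1.Met P (fun i => (ρ.2 i : N)) e (fun i => (a i : N)) := by
  classical
  induction R using Finset.induction_on with
  | empty => exact ⟨X, subset_rfl, hX, hXB, by simp⟩
  | insert ρ R _ ih =>
    obtain ⟨Y, hYX, hY, hYB, hR⟩ := ih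
    obtain ⟨⟨p, r, ψ⟩, b⟩ := ρ
    by_cases h : ∃ e ∈ Y, ∃ z : Fin p → N, (∀ i, z i ∈ predSet P N) ∧
        ψ.Realize (Sum.elim z (Sum.elim (fun i => (b i : N)) e))
    · obtain ⟨e, he, z, hz, hψ⟩ := h
      have hD : B.Definable L {z : Fin p → N | ∃ e : Fin t → N, Sum.elim z e ∈
          {g : Fin p ⊕ Fin t → N | (fun i => g (Sum.inr i)) ∈ Y ∧
            ψ.Realize (Sum.elim (fun i => g (Sum.inl i))
              (Sum.elim (fun i => (b i : N)) fun i => g (Sum.inr i)))}} := by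
        refine Set.Definable.exists_of_finite ((hYB.preimage_comp Sum.inr).inter ?_)
        refine definable_setOf_realize ψ _ ?_
        rintro (i | i | i)
        exacts [Or.inr ⟨_, fun _ => rfl⟩, Or.inl ⟨_, hAB (b i).2, fun _ => rfl⟩,
          Or.inr ⟨_, fun _ => rfl⟩]
      obtain ⟨a, haP, e', he', hψ'⟩ := hB.exists_mem_of_definable hD hz ⟨e, he, hψ⟩
      refine ⟨Y ∩ {e | ψ.Realize (Sum.elim a (Sum.elim (fun i => (b i : N)) e))},
        Set.inter_subset_left.trans hYX, ⟨e', he', hψ'⟩, hYB.inter ?_, ?_⟩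
      · refine definable_setOf_realize ψ _ ?_
        rintro (i | i | i)
        exacts [Or.inl ⟨_, (haP i).2, fun _ => rfl⟩, Or.inl ⟨_, hAB (b i).2, fun _ => rfl⟩,
          Or.inr ⟨_, fun _ => rfl⟩]
      · intro ρ hρ
        obtain rfl | hρ := Finset.mem_insert.1 hρ
        · exact ⟨fun i => ⟨a i, hPA (haP i)⟩, fun e he _ => ⟨fun i => (haP i).1, he.2⟩⟩
        · obtain ⟨a', ha'⟩ := hR ρ hρ
          exact ⟨a', fun e he => ha' e he.1⟩
    -- No point of `Y` has a witness, so the new requirement is vacuous and any tuple in A will do.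
    · refine ⟨Y, hYX, hY, hYB, fun ρ hρ => ?_⟩
      obtain rfl | hρ := Finset.mem_insert.1 hρ
      · exact ⟨fun _ => ⟨hA.some, hA.some_mem⟩, fun e he h' => (h ⟨e, he, h'⟩).elim⟩
      · exact hR ρ hρ

end Requirements

/-! ### Binary trees and names for the elements of A' -/

section Tree

variable {L : FirstOrder.Language.{u, v}} {Λ : Type w} [LinearOrder Λ] {t m : ℕ}

/-- The nodes of the binary tree of height `Λ`. -/
abbrev Node (Λ : Type w) [LinearOrder Λ] : Type w := Σ i : Λ, (Set.Iio i → Bool)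

/-- The node of the branch `η` at level `i`. -/
def trunc (η : Λ → Bool) (i : Λ) : Node Λ := ⟨i, fun l => η l⟩

open Classical in
/-- A branch through a node. -/
noncomputable def Node.branch (s : Node Λ) : Λ → Bool :=
  fun l => if h : l < s.1 then s.2 ⟨l, h⟩ else false

theorem branch_trunc {η : Λ → Bool} {i l : Λ} (h : l < i) : (trunc η i).branch l = η l := by
  simp [trunc, Node.branch, h]

theorem trunc_congr {η η' : Λ → Bool} {i : Λ} (h : ∀ l < i, η l = η' l) :
    trunc η i = trunc η' i := by
  unfold trunc
  congr 1
  ext ⟨l, hl⟩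
  exact h l hl

variable (L Λ t m) in
/-- Names for the parameters attached to the nodes, for witnesses of requirements along branches
and for the values of Skolem functions. -/
inductive WitTerm : Type (max u v w)
  | node (s : Node Λ) (j : Fin m) : WitTerm
  | wit (s : Node Λ) (q : Req L t) (k : Fin q.2.1 → WitTerm) (j : Fin q.1) : WitTerm
  | sk (r : ℕ) (φ : L.BoundedFormula Empty (r + 1)) (k : Fin r → WitTerm) : WitTerm

namespace WitTerm

/-- All nodes that occur in the term have a level less than `i`. -/
def Below (i : Λ) : WitTerm L Λ t m → Prop
  | node s _ => s.1 < i
  | wit s _ k _ => s.1 < i ∧ ∀ l, (k l).Below i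
  | sk _ _ k => ∀ l, (k l).Below i

theorem Below.mono {i j : Λ} (hij : i ≤ j) {k : WitTerm L Λ t m} (h : k.Below i) :
    k.Below j := by
  induction k with
  | node s j => exact lt_of_lt_of_le (b := i) h hij
  | wit s q k j ih => exact ⟨h.1.trans_le hij, fun l => ih l (h.2 l)⟩
  | sk r φ k ih => exact fun l => ih l (h l)

theorem exists_forall_below_of_forall_exists [Nonempty Λ] {r : ℕ} {k : Fin r → WitTerm L Λ t m}
    (h : ∀ l, ∃ i, (k l).Below i) : ∃ i, ∀ l, (k l).Below i := by
  choose i hi using h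
  obtain ⟨j, hj⟩ := (Set.finite_range i).bddAbove
  exact ⟨j, fun l => (hi l).mono (hj ⟨l, rfl⟩)⟩

/-- A term mentions finitely many nodes and Λ has no last level. Hence every requirement with named
parameters is treated at some level of each branch. -/
theorem exists_below [Nonempty Λ] [NoMaxOrder Λ] (k : WitTerm L Λ t m) : ∃ i, k.Below i := by
  induction k with
  | node s j => exact exists_gt s.1
  | wit s q k j ih =>
    obtain ⟨i, hi⟩ := exists_forall_below_of_forall_exists ih
    obtain ⟨j, hj⟩ := exists_gt (max i s.1)
    exact ⟨j, (le_max_right _ _).trans_lt hj,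
      fun l => (hi l).mono ((le_max_left _ _).trans hj.le)⟩
  | sk r φ k ih => exact exists_forall_below_of_forall_exists ih

theorem exists_forall_below [Nonempty Λ] [NoMaxOrder Λ] {r : ℕ} (k : Fin r → WitTerm L Λ t m) :
    ∃ i, ∀ l, (k l).Below i :=
  exists_forall_below_of_forall_exists fun l => exists_below (k l)

variable {A : Type*}

/-- The value of a term. -/
def val (y : Node Λ → Fin m → A) (wt : Node Λ → (q : Req L t) → (Fin q.2.1 → A) → Fin q.1 → A)
    (sf : (r : ℕ) → L.BoundedFormula Empty (r + 1) → (Fin r → A) → A) : WitTerm L Λ t m → A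
  | node s j => y s j
  | wit s q k j => wt s q (fun l => (k l).val y wt sf) j
  | sk r φ k => sf r φ fun l => (k l).val y wt sf

theorem val_congr {y y' : Node Λ → Fin m → A}
    {wt wt' : Node Λ → (q : Req L t) → (Fin q.2.1 → A) → Fin q.1 → A}
    {sf : (r : ℕ) → L.BoundedFormula Empty (r + 1) → (Fin r → A) → A} {i : Λ}
    (hy : ∀ s : Node Λ, s.1 < i → y s = y' s) (hw : ∀ s : Node Λ, s.1 < i → wt s = wt' s)
    {k : WitTerm L Λ t m} (h : k.Below i) : k.val y wt sf = k.val y' wt' sf := by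
  induction k with
  | node s j => exact congrFun (hy s h) j
  | wit s q k j ih =>
    simp only [val]
    rw [hw s h.1, funext fun l => ih l (h.2 l)]
  | sk r φ k ih =>
    simp only [val]
    rw [funext fun l => ih l (h l)]

end WitTerm

end Tree

/-! ### Finite approximations to the tree -/

section Stage

variable {L : FirstOrder.Language.{u, v}} {N : Type*} [L.Structure N] {Λ : Type w}
  [LinearOrder Λ] {t m : ℕ}

open WitTerm in
/-- If every nonempty definable subset of `X` is split by some instance of `φ`, then the tree of
`φ`-instances with witnesses for requirements exists on every finite set of levels. -/
theorem exists_finite_tree {P : L.Relations 1} {A B : Set N} (hB : IsCompleteSet P B)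
    (hAB : A ⊆ B) (hPA : predSet P N ∩ B ⊆ A) (hA : A.Nonempty)
    {X : Set (Fin t → N)} (hX : X.Nonempty) (hXB : B.Definable L X)
    (φ : L.Formula (Fin t ⊕ Fin m))
    (hsplit : ∀ Y ⊆ X, Y.Nonempty → B.Definable L Y → ∃ y : Fin m → A,
      (∃ e ∈ Y, φ.Realize (Sum.elim e fun i => (y i : N))) ∧
        ∃ e ∈ Y, ¬ φ.Realize (Sum.elim e fun i => (y i : N)))
    (sf : (r : ℕ) → L.BoundedFormula Empty (r + 1) → (Fin r → A) → A)
    (R : Finset (Σ q : Req L t, Fin q.2.1 → WitTerm L Λ t m)) (F : Finset Λ) :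
    ∃ (y : Node Λ → Fin m → A) (wt : Node Λ → (q : Req L t) → (Fin q.2.1 → A) → Fin q.1 → A)
      (Y : (Λ → Bool) → Set (Fin t → N)),
      (∀ η, Y η ⊆ X ∧ (Y η).Nonempty ∧ B.Definable L (Y η)) ∧
      (∀ η η', (∀ l, (∃ i ∈ F, l ≤ i) → η l = η' l) → Y η = Y η') ∧
      (∀ i ∈ F, ∀ η, ∀ e ∈ Y η,
        (φ.Realize (Sum.elim e fun j => (y (trunc η i) j : N)) ↔ η i = true)) ∧
      ∀ i ∈ F, ∀ η, ∀ ρ ∈ R, (∀ l, (ρ.2 l).Below i) → ∀ e ∈ Y η,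
        ρ.1.Met P (fun l => (((ρ.2 l).val y wt sf : A) : N)) e
          (fun j => (wt (trunc η i) ρ.1 (fun l => (ρ.2 l).val y wt sf) j : N)) := by
  classical
  -- Levels are added from below, so a new level only refines the sets already attached to the
  -- branches.
  induction F using Finset.induction_on_max with
  | empty =>
    exact ⟨fun _ _ => ⟨hA.some, hA.some_mem⟩, fun _ _ _ _ => ⟨hA.some, hA.some_mem⟩, fun _ => X,
      fun _ => ⟨subset_rfl, hX, hXB⟩, fun _ _ _ => rfl, by simp, by simp⟩
  | insert i F hi ih =>
    obtain ⟨y, wt, Y, hY, hYc, hYφ, hYR⟩ := ih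
    have key : ∀ η : Λ → Bool, ∃ (b : Fin m → A)
        (w : (q : Req L t) → (Fin q.2.1 → A) → Fin q.1 → A) (Z : Set (Fin t → N)),
        Z ⊆ Y η ∧ B.Definable L Z ∧
        (∃ e ∈ Z, φ.Realize (Sum.elim e fun i => (b i : N))) ∧
        (∃ e ∈ Z, ¬ φ.Realize (Sum.elim e fun i => (b i : N))) ∧
        ∀ ρ ∈ R, ∀ e ∈ Z, ρ.1.Met P (fun l => (((ρ.2 l).val y wt sf : A) : N)) e
          (fun j => (w ρ.1 (fun l => (ρ.2 l).val y wt sf) j : N)) := by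
      intro η
      let f : (Σ q : Req L t, Fin q.2.1 → WitTerm L Λ t m) → Σ q : Req L t, Fin q.2.1 → A :=
        fun ρ => ⟨ρ.1, fun l => (ρ.2 l).val y wt sf⟩
      obtain ⟨Z, hZY, hZ, hZB, hZR⟩ := exists_subset_met hB hAB hPA hA (R.image f)
        (hY η).2.1 (hY η).2.2
      obtain ⟨b, h1, h2⟩ := hsplit Z (hZY.trans (hY η).1) hZ hZB
      have hw : ∀ (q : Req L t) (a : Fin q.2.1 → A), ∃ w : Fin q.1 → A, ⟨q, a⟩ ∈ R.image f →
          ∀ e ∈ Z, q.Met P (fun i => (a i : N)) e (fun i => (w i : N)) := by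
        intro q a
        by_cases h : ⟨q, a⟩ ∈ R.image f
        · obtain ⟨w, hw⟩ := hZR _ h
          exact ⟨w, fun _ => hw⟩
        · exact ⟨fun _ => ⟨hA.some, hA.some_mem⟩, fun h' => (h h').elim⟩
      choose w hw using hw
      exact ⟨b, w, Z, hZY, hZB, h1, h2, fun ρ hρ => hw _ _ (Finset.mem_image_of_mem f hρ)⟩
    choose b w Z hZY hZB hZ1 hZ2 hZR using key
    -- `Y η` depends only on η up to the old levels, all below `i`. So choices made for the
    -- canonical branch through a node serve all branches through it, and parameters and witnesses
    -- depend on the node alone.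
    have hYtr : ∀ η, Y (trunc η i).branch = Y η := fun η => hYc _ _ fun l ⟨j, hj, hlj⟩ =>
      branch_trunc (hlj.trans_lt (hi j hj))
    let y' : Node Λ → Fin m → A := fun s => if s.1 = i then b s.branch else y s
    let wt' : Node Λ → (q : Req L t) → (Fin q.2.1 → A) → Fin q.1 → A :=
      fun s => if s.1 = i then w s.branch else wt s
    have hy' : ∀ s : Node Λ, s.1 < i → y s = y' s := fun s hs => (if_neg hs.ne).symm
    have hwt' : ∀ s : Node Λ, s.1 < i → wt s = wt' s := fun s hs => (if_neg hs.ne).symm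
    have hyi : ∀ η, y' (trunc η i) = b (trunc η i).branch := fun η => if_pos rfl
    have hwi : ∀ η, wt' (trunc η i) = w (trunc η i).branch := fun η => if_pos rfl
    -- Only data at level `i` are redefined, so terms below `i` keep their values and the witnesses
    -- chosen for the old values remain correct.
    have hval : ∀ k : WitTerm L Λ t m, k.Below i → k.val y wt sf = k.val y' wt' sf :=
      fun k hk => val_congr hy' hwt' hk
    refine ⟨y', wt', fun η => Z (trunc η i).branch ∩
      {e | φ.Realize (Sum.elim e fun j => (b (trunc η i).branch j : N)) ↔ η i = true},
      fun η => ⟨?_, ?_, ?_⟩, ?_, ?_, ?_⟩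
    · exact Set.inter_subset_left.trans ((hZY _).trans ((hYtr η).subset.trans (hY η).1))
    · cases h : η i
      · obtain ⟨e, he, hφ⟩ := hZ2 (trunc η i).branch
        exact ⟨e, he, by simpa [h] using hφ⟩
      · obtain ⟨e, he, hφ⟩ := hZ1 (trunc η i).branch
        exact ⟨e, he, by simpa [h] using hφ⟩
    · refine (hZB _).inter ?_
      have hd : B.Definable L
          {e | φ.Realize (Sum.elim e fun j => (b (trunc η i).branch j : N))} := by
        refine definable_setOf_realize φ _ ?_
        rintro (j | j)
        exacts [Or.inr ⟨_, fun _ => rfl⟩, Or.inl ⟨_, hAB (b _ j).2, fun _ => rfl⟩]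
      cases h : η i
      · simpa [Set.compl_def] using hd.compl
      · simpa using hd
    · intro η η' h
      have h1 : trunc η i = trunc η' i :=
        trunc_congr fun l hl => h l ⟨i, Finset.mem_insert_self _ _, hl.le⟩
      have h2 : η i = η' i := h i ⟨i, Finset.mem_insert_self _ _, le_rfl⟩
      simp only [h1, h2]
    · intro j hj η e he
      obtain rfl | hj := Finset.mem_insert.1 hj
      · rw [hyi]
        exact he.2
      · rw [← hy' (trunc η j) (hi j hj)]
        exact hYφ j hj η e ((hYtr η).subset (hZY _ he.1))
    · intro j hj η ρ hρ hb e he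
      obtain rfl | hj := Finset.mem_insert.1 hj
      · rw [hwi]
        simp only [← hval _ (hb _)]
        exact hZR _ ρ hρ e he.1
      · rw [← hwt' (trunc η j) (hi j hj)]
        simp only [← hval _ ((hb _).mono (hi j hj).le)]
        exact hYR j hj η ρ hρ hb e ((hYtr η).subset (hZY _ he.1))

end Stage

/-! ### Cardinal arithmetic: few nodes and names, many branches -/

section Cardinality

/-- A well-order of height greater than the continuum such that the binary tree on it has few
nodes and many branches. -/
theorem exists_wellOrder_mk_node_le : ∃ (Λ : Type w) (_ : LinearOrder Λ), Nonempty Λ ∧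
    NoMaxOrder Λ ∧ WellFoundedLT Λ ∧ #(Node Λ) ≤ 2 ^ (ℵ₀ : Cardinal.{w}) ∧
      (2 : Cardinal.{w}) ^ (ℵ₀ : Cardinal.{w}) < 2 ^ #Λ := by
  -- The height is the least cardinal in `S`. By minimality each level has at most 2^ℵ₀ nodes, and
  -- by Cantor's theorem 2^ℵ₀ ∈ `S`, so there are at most 2^ℵ₀ levels.
  let S : Set Cardinal.{w} := {c | (2 : Cardinal.{w}) ^ (ℵ₀ : Cardinal.{w}) < 2 ^ c}
  have hS : S.Nonempty := ⟨_, cantor _⟩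
  have h1 : (2 : Cardinal.{w}) ^ (ℵ₀ : Cardinal.{w}) < 2 ^ sInf S := csInf_mem hS
  have h2 : ∀ c < sInf S, (2 : Cardinal.{w}) ^ c ≤ 2 ^ (ℵ₀ : Cardinal.{w}) :=
    fun c hc => not_lt.1 fun h => notMem_of_lt_csInf' hc h
  have h3 : ℵ₀ ≤ sInf S := by
    by_contra h
    exact (power_le_power_left two_ne_zero (not_le.1 h).le).not_gt h1
  have hΛ : #(sInf S).ord.ToType = sInf S := by simp
  refine ⟨(sInf S).ord.ToType, inferInstance, ?_, noMaxOrder h3, inferInstance, ?_, by rwa [hΛ]⟩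
  · rw [← mk_ne_zero_iff, hΛ]
    exact (aleph0_pos.trans_le h3).ne'
  · rw [mk_sigma]
    refine (sum_le_sum _ (fun _ => 2 ^ (ℵ₀ : Cardinal.{w})) fun i => ?_).trans ?_
    · simp only [mk_arrow, mk_bool, lift_ofNat, lift_uzero]
      refine h2 _ ?_
      have := mk_Iio_lt i (by simp)
      rwa [hΛ] at this
    · rw [sum_const', hΛ]
      refine (mul_le_mul' (csInf_le' (cantor _) : sInf S ≤ _) le_rfl).trans ?_
      rw [mul_eq_self (cantor _).le]

variable {L : FirstOrder.Language.{u, v}} {Λ : Type (max u v)} [LinearOrder Λ] {t m : ℕ}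

variable (L Λ t m) in
/-- The head symbols of terms in `WitTerm`. -/
abbrev WitTerm.Label : Type (max u v) :=
  (Node Λ × Fin m) ⊕ (Node Λ × Σ q : Req L t, Fin q.1) ⊕ Σ r : ℕ, L.BoundedFormula Empty (r + 1)

/-- The arities of the head symbols. -/
def WitTerm.Arity : WitTerm.Label L Λ t m → Type
  | Sum.inl _ => Fin 0
  | Sum.inr (Sum.inl s) => Fin s.2.1.2.1
  | Sum.inr (Sum.inr r) => Fin r.1

/-- The term described by a well-founded tree. -/
def WitTerm.ofWType : WType (WitTerm.Arity (L := L) (Λ := Λ) (t := t) (m := m)) →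
    WitTerm L Λ t m
  | ⟨Sum.inl s, _⟩ => .node s.1 s.2
  | ⟨Sum.inr (Sum.inl s), k⟩ => .wit s.1 s.2.1 (fun i => ofWType (k i)) s.2.2
  | ⟨Sum.inr (Sum.inr r), k⟩ => .sk r.1 r.2 fun i => ofWType (k i)

theorem WitTerm.ofWType_surjective :
    Function.Surjective (WitTerm.ofWType (L := L) (Λ := Λ) (t := t) (m := m)) := by
  intro k
  induction k with
  | node s j => exact ⟨⟨Sum.inl (s, j), Fin.elim0⟩, rfl⟩
  | wit s q k j ih =>
    choose g hg using ih
    exact ⟨⟨Sum.inr (Sum.inl (s, ⟨q, j⟩)), g⟩, by simp [ofWType, hg]⟩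
  | sk r φ k ih =>
    choose g hg using ih
    exact ⟨⟨Sum.inr (Sum.inr ⟨r, φ⟩), g⟩, by simp [ofWType, hg]⟩

/-- Terms are finitely branching well-founded trees, so there are at most max(ℵ₀, number of head
symbols) of them; a head symbol is a formula, or a node with one of countably many labels. -/
theorem WitTerm.mk_le (hL : L.card ≤ ℵ₀) (hΛ : #(Node Λ) ≤ 2 ^ (ℵ₀ : Cardinal.{max u v})) :
    #(WitTerm L Λ t m) ≤ 2 ^ (ℵ₀ : Cardinal.{max u v}) := by
  have hc : Countable L.Symbols := mk_le_aleph0_iff.1 hL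
  have hc' : Countable (Σ r : ℕ, L.BoundedFormula Empty (r + 1)) :=
    Function.Injective.countable
      (f := fun x => (⟨x.1 + 1, x.2⟩ : Σ r : ℕ, L.BoundedFormula Empty r)) (by
        rintro ⟨r, φ⟩ ⟨r', φ'⟩ h
        simp only [Sigma.mk.injEq, Nat.add_right_cancel_iff] at h
        obtain ⟨rfl, h⟩ := h
        rw [eq_of_heq h])
  have hω : (ℵ₀ : Cardinal.{max u v}) ≤ 2 ^ (ℵ₀ : Cardinal.{max u v}) := (cantor _).le
  have hfin : ∀ a, Finite (WitTerm.Arity (L := L) (Λ := Λ) (t := t) (m := m) a) := by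
    rintro (s | s | r) <;> unfold WitTerm.Arity <;> infer_instance
  have hmul : ∀ (β : Type (max u v)) [Countable β],
      #(Node Λ × β) ≤ 2 ^ (ℵ₀ : Cardinal.{max u v}) := fun β _ => by
    rw [mk_prod, lift_id, lift_id]
    exact (mul_le_mul' hΛ ((mk_le_aleph0_iff.2 inferInstance).trans hω)).trans
      (mul_eq_self hω).le
  refine (mk_le_of_surjective WitTerm.ofWType_surjective).trans
    ((WType.cardinalMk_le_max_aleph0_of_finite').trans (max_le ?_ hω))
  rw [lift_id', mk_sum, mk_sum]
  simp only [lift_id]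
  refine add_le_of_le hω ?_ (add_le_of_le hω (hmul _) ((mk_le_aleph0_iff.2 hc').trans hω))
  have := hmul (ULift.{max u v} (Fin m))
  rwa [mk_congr (Equiv.prodCongr (Equiv.refl _) Equiv.ulift)] at this

end Cardinality

/-! ### Ultrapowers and Łoś's theorem for Skolem-closed sets of classes -/

section Ultrapower

variable {L : FirstOrder.Language.{u, v}} {I : Type*} {N : Type*} [L.Structure N]
  (U : Ultrafilter I)

/-- The ultrapower of a structure. -/
abbrev Ultrapower (N : Type*) : Type _ := (U : Filter I).Product fun _ => N

/-- The class of a function in the ultrapower. -/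
def cls (f : I → N) : Ultrapower U N :=
  @Quotient.mk' _ ((U : Filter I).productSetoid fun _ => N) f

variable {U}

theorem cls_eq_cls {f g : I → N} : cls U f = cls U g ↔ ∀ᶠ i in U, f i = g i :=
  @Quotient.eq'' _ ((U : Filter I).productSetoid fun _ => N) f g

theorem exists_cls_eq (x : Ultrapower U N) : ∃ f, cls U f = x :=
  @Quotient.exists_rep _ ((U : Filter I).productSetoid fun _ => N) x

theorem realize_cls [Nonempty N] {β : Type*} (φ : L.Formula β) (f : β → I → N) :
    φ.Realize (fun c => cls U (f c)) ↔ ∀ᶠ i in U, φ.Realize fun c => f c i :=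
  Ultraproduct.realize_formula_cast φ f

theorem realize_cls_elim [Nonempty N] {α β : Type*} (φ : L.Formula (α ⊕ β)) (f : α → I → N)
    (g : β → I → N) :
    φ.Realize (Sum.elim (fun c => cls U (f c)) fun c => cls U (g c)) ↔
      ∀ᶠ i in U, φ.Realize (Sum.elim (fun c => f c i) fun c => g c i) := by
  have h := realize_cls (U := U) φ (Sum.elim f g)
  have h1 : (fun c => cls U (Sum.elim f g c)) =
      Sum.elim (fun c => cls U (f c)) fun c => cls U (g c) := by ext (c | c) <;> rfl
  have h2 : ∀ i, (fun c => Sum.elim f g c i) = Sum.elim (fun c => f c i) fun c => g c i :=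
    fun i => by ext (c | c) <;> rfl
  simpa only [h1, h2] using h

theorem relMap_cls {n : ℕ} (r : L.Relations n) (f : Fin n → I → N) :
    Structure.RelMap r (fun c => cls U (f c)) ↔ ∀ᶠ i in U, Structure.RelMap r fun c => f c i :=
  relMap_quotient_mk' ((U : Filter I).productSetoid fun _ => N) r f

theorem mem_predSet_iff {P : L.Relations 1} {M : Type*} [L.Structure M] {x : M} :
    x ∈ predSet P M ↔ Structure.RelMap P fun _ => x :=
  iff_of_eq (congrArg (Structure.RelMap P) (funext fun i => by simp))

theorem cls_mem_predSet {P : L.Relations 1} {f : I → N} :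
    cls U f ∈ predSet P (Ultrapower U N) ↔ ∀ᶠ i in U, f i ∈ predSet P N := by
  simp only [mem_predSet_iff]
  exact relMap_cls P fun _ => f

/-- A subset of an ultrapower that consists of classes of functions into `A` and is closed under
Skolem functions of `A` is elementarily equivalent to `A`. -/
theorem elementarilyEquivalent_range_cls [L.IsRelational] {A : Set N} {K : Type*}
    (val : K → I → setSub (L := L) A)
    (hsk : ∀ (r : ℕ) (φ : L.BoundedFormula Empty (r + 1)) (k : Fin r → K), ∃ k', ∀ i,
      (∃ a, φ.Realize default (Fin.snoc (fun l => val (k l) i) a)) →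
        φ.Realize default (Fin.snoc (fun l => val (k l) i) (val k' i))) :
    (setSub (L := L) (Set.range fun k => cls U fun i => (val k i : N))) ≅[L]
      (setSub (L := L) A) := by
  set A' := setSub (L := L) (Set.range fun k => cls U fun i => (val k i : N)) with hA'
  let c : K → A' := fun k => ⟨cls U fun i => (val k i : N), k, rfl⟩
  have hc : ∀ a : A', ∃ k, c k = a := fun ⟨a, k, hk⟩ => ⟨k, Subtype.ext hk⟩
  have hterm : ∀ {n : ℕ} (s : L.Term (Empty ⊕ Fin n)), ∃ l, s = Term.var (Sum.inr l) := by
    intro n s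
    rcases s with (s | s) | ⟨f, _⟩
    · exact s.elim
    · exact ⟨s, rfl⟩
    · exact isEmptyElim f
  -- Łoś's theorem for A', which need not contain the classes of all functions into A.
  have key : ∀ {n : ℕ} (φ : L.BoundedFormula Empty n) (k : Fin n → K),
      φ.Realize default (fun l => c (k l)) ↔
        ∀ᶠ i in U, φ.Realize default (fun l => val (k l) i) := by
    intro n φ
    induction φ with
    | falsum => intro k; simp [BoundedFormula.Realize, U.neBot.ne]
    | equal s₁ s₂ =>
      intro k
      obtain ⟨l₁, rfl⟩ := hterm s₁
      obtain ⟨l₂, rfl⟩ := hterm s₂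
      simp only [BoundedFormula.Realize, Term.realize_var, Sum.elim_inr]
      rw [Subtype.ext_iff]
      exact cls_eq_cls.trans (Filter.eventually_congr (Filter.Eventually.of_forall fun i =>
        Subtype.ext_iff.symm))
    | rel r ts =>
      intro k
      choose l hl using fun i => hterm (ts i)
      obtain rfl : ts = fun i => Term.var (Sum.inr (l i)) := funext hl
      simp only [BoundedFormula.Realize, Term.realize_var, Sum.elim_inr]
      exact relMap_cls r fun j i => (val (k (l j)) i : N)
    | imp φ ψ h1 h2 =>
      intro k
      simp only [BoundedFormula.realize_imp, h1, h2, Ultrafilter.eventually_imp]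
    | all φ ih =>
      intro k
      simp only [BoundedFormula.realize_all]
      have hs : ∀ k', φ.Realize default (Fin.snoc (fun l => c (k l)) (c k')) ↔
          ∀ᶠ i in U, φ.Realize default (Fin.snoc (fun l => val (k l) i) (val k' i)) := by
        intro k'
        have := ih (Fin.snoc k k')
        convert! this using 2
        · ext j; refine Fin.lastCases ?_ (fun j => ?_) j <;> simp
        · ext i
          refine iff_of_eq (congrArg _ (funext fun j => ?_))
          refine Fin.lastCases ?_ (fun j => ?_) j <;> simp
      constructor
      · intro h
        -- The Skolem function of ¬φ names a counterexample at every index that has one.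
        obtain ⟨k', hk'⟩ := hsk _ φ.not k
        refine ((hs k').1 (h _)).mono fun i hi a => ?_
        by_contra ha
        exact hk' i ⟨a, ha⟩ hi
      · intro h a
        obtain ⟨k', rfl⟩ := hc a
        exact (hs k').2 (h.mono fun i hi => hi _)
  rw [elementarilyEquivalent_iff]
  intro φ
  have h := key φ Fin.elim0
  have h1 : (fun l => c (Fin.elim0 l)) = (default : Fin 0 → A') := Subsingleton.elim _ _
  have h2 : ∀ i, (fun l => val (Fin.elim0 l) i) = (default : Fin 0 → setSub (L := L) A) :=
    fun i => Subsingleton.elim _ _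
  simp only [h1, h2, Filter.eventually_const] at h
  exact h

end Ultrapower

/-! ### Membership in S_* -/

section SStar

variable {L : FirstOrder.Language.{u, v}} {M : Type w} [L.Structure M] {P : L.Relations 1}

theorem tp_mem_SStar {A : Set M} {t : ℕ} {e : Fin t → M}
    (hP : predSet P M ∩ (A ∪ Set.range e) ⊆ A) (hc : IsCompleteSet P (A ∪ Set.range e)) :
    tp (Subtype.val : A → M) e ∈ SStar P A t := by
  refine ⟨M, inferInstance, ElementaryEmbedding.refl L M, e, ?_, ?_, rfl⟩
  · have : (ElementaryEmbedding.refl L M) '' A = A := Set.image_id A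
    rw [this]
    exact subset_antisymm (fun x hx => ⟨hx.1, hP hx⟩) fun x hx => ⟨hx.1, Or.inl hx.2⟩
  · have : (ElementaryEmbedding.refl L M) '' A = A := Set.image_id A
    rwa [this]

/-- If every requirement on the tuple `e` with parameters in `A` that has a witness has a witness
in `A`, then `A ∪ e` is complete and has no new elements in `P`. -/
theorem tp_mem_SStar_of_forall_req {A : Set M} (hA : A.Nonempty) {t : ℕ} {e : Fin t → M}
    (h : ∀ (q : Req L t) (b : Fin q.2.1 → A), ∃ a : Fin q.1 → A,
      q.Met P (fun i => (b i : M)) e (fun i => (a i : M))) :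
    tp (Subtype.val : A → M) e ∈ SStar P A t := by
  refine tp_mem_SStar ?_ ?_
  · rintro x ⟨hxP, hxA | ⟨j, rfl⟩⟩
    · exact hxA
    -- The requirement (∃ z ∈ P) z = e_j: its witness in A can only be e_j itself.
    · let q : Req L t := ⟨1, 0, (Term.var (Sum.inl 0)).equal (Term.var (Sum.inr (Sum.inr j)))⟩
      obtain ⟨a, ha⟩ := h q Fin.elim0
      have := (ha ⟨fun _ => e j, fun _ => hxP, by simp [q, Formula.realize_equal]⟩).2
      simp only [q, Formula.realize_equal, Term.realize_var, Sum.elim_inl, Sum.elim_inr] at this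
      exact this ▸ (a 0).2
  · intro m n ψ b hb ⟨z, hz, hψ⟩
    have hg : ∀ i, ∃ g : A ⊕ Fin t, b i = Sum.elim Subtype.val e g := fun i =>
      (hb i).elim (fun hi => ⟨Sum.inl ⟨b i, hi⟩, rfl⟩) fun ⟨j, hj⟩ => ⟨Sum.inr j, hj.symm⟩
    choose g hg using hg
    let q : Req L t := ⟨m, n, ψ.relabel (Sum.map id fun i =>
      Sum.elim (fun _ => Sum.inl i) Sum.inr (g i))⟩
    -- Coordinates that come from `e` get a dummy value, which the relabelled formula never reads.
    let b' : Fin n → A := fun i => Sum.elim id (fun _ => ⟨hA.some, hA.some_mem⟩) (g i)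
    have hq : ∀ z : Fin m → M, q.2.2.Realize (Sum.elim z (Sum.elim (fun i => (b' i : M)) e)) ↔
        ψ.Realize (Sum.elim z b) := fun z => by
      rw [Formula.realize_relabel]
      refine iff_of_eq (congrArg _ (funext ?_))
      rintro (i | i)
      · rfl
      · simp only [Function.comp_apply, Sum.map_inr, Sum.elim_inr, hg i, b']
        rcases h : g i with x | x <;> simp [h]
    obtain ⟨a, ha⟩ := h q b'
    obtain ⟨h1, h2⟩ := ha ⟨z, hz, (hq z).2 hψ⟩
    exact ⟨fun i => a i, fun i => ⟨h1 i, Or.inl (a i).2⟩, (hq _).1 h2⟩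

end SStar

/-! ### Density for instances over A -/

section Density

variable {L : FirstOrder.Language.{u, v}} [L.IsRelational]

open WitTerm in
/-- If `A` is stable over `P` and `B ⊇ A` is complete with `P ∩ B ⊆ A`, then every nonempty set
definable over `B` has a nonempty subset definable over `B` on which all instances of `φ` over `A`
are constant. -/
theorem StableOver.exists_subset_forall_realize_iff (hL : L.card ≤ ℵ₀) {T : L.Theory}
    {P : L.Relations 1} {N : Type (max u v)} [L.Structure N] [Nonempty N] (hN : N ⊨ T) {A B : Set N}
    (hst : StableOver T P A) (hA : A.Nonempty) (hB : IsCompleteSet P B)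
    (hAB : A ⊆ B) (hPA : predSet P N ∩ B ⊆ A) {t m : ℕ} {X : Set (Fin t → N)} (hX : X.Nonempty)
    (hXB : B.Definable L X) (φ : L.Formula (Fin t ⊕ Fin m)) :
    ∃ Y ⊆ X, Y.Nonempty ∧ B.Definable L Y ∧ ∀ y : Fin m → A, ∀ e ∈ Y, ∀ e' ∈ Y,
      φ.Realize (Sum.elim e fun i => (y i : N)) → φ.Realize (Sum.elim e' fun i => (y i : N)) := by
  classical
  by_contra! hno
  have hsplit : ∀ Y ⊆ X, Y.Nonempty → B.Definable L Y → ∃ y : Fin m → A,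
      (∃ e ∈ Y, φ.Realize (Sum.elim e fun i => (y i : N))) ∧
        ∃ e ∈ Y, ¬ φ.Realize (Sum.elim e fun i => (y i : N)) := fun Y h1 h2 h3 =>
    let ⟨y, e, he, e', he', h, h'⟩ := hno Y h1 h2 h3
    ⟨y, ⟨e, he, h⟩, e', he', h'⟩
  obtain ⟨Λ, _, _, _, _, hnode, hbranch⟩ := exists_wellOrder_mk_node_le.{max u v}
  let a₀ : setSub (L := L) A := ⟨hA.some, hA.some_mem⟩
  have hsf : ∀ (r : ℕ) (χ : L.BoundedFormula Empty (r + 1)) (k : Fin r → setSub (L := L) A),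
      ∃ a : setSub (L := L) A, (∃ a : setSub (L := L) A, χ.Realize default (Fin.snoc k a)) →
        χ.Realize default (Fin.snoc k a) := fun r χ k => by
    by_cases h : ∃ a : setSub (L := L) A, χ.Realize default (Fin.snoc k a)
    · exact ⟨h.choose, fun _ => h.choose_spec⟩
    · exact ⟨a₀, fun h' => (h h').elim⟩
  choose sf hsf using hsf
  let K := WitTerm L Λ t m
  let I := Finset (Σ q : Req L t, Fin q.2.1 → K) × Finset Λ
  have htree := fun i : I => exists_finite_tree hB hAB hPA hA hX hXB φ hsplit sf i.1 i.2
  choose y wt Y hY _ hYφ hYR using htree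
  choose c hc using fun i η => (hY i η).2.1
  -- For this ultrafilter on pairs of finite sets, any given requirement and level are eventually
  -- included in the finite approximation.
  let U : Ultrafilter I := Ultrafilter.of Filter.atTop
  have hU : ∀ i : I, ∀ᶠ j in U, i ≤ j := fun i =>
    Ultrafilter.of_le _ (Filter.eventually_ge_atTop i)
  let M := Ultrapower U N
  let val : K → I → setSub (L := L) A := fun k i => k.val (y i) (wt i) sf
  let A' : Set M := Set.range fun k => cls U fun i => (val k i : N)
  let e : (Λ → Bool) → Fin t → M := fun η j => cls U fun i => c i η j
  have hM : M ⊨ T := ⟨fun χ hχ => (Ultraproduct.sentence_realize χ).2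
    (Filter.Eventually.of_forall fun _ => hN.realize_of_mem χ hχ)⟩
  have hA' : A'.Nonempty := ⟨_, .sk 0 ⊥ Fin.elim0, rfl⟩
  have heq : (setSub (L := L) A') ≅[L] (setSub (L := L) A) := by
    refine elementarilyEquivalent_range_cls val fun r χ k => ⟨.sk r χ k, fun i => ?_⟩
    exact hsf r χ fun l => val (k l) i
  have hS : ∀ η, tp (Subtype.val : A' → M) (e η) ∈ SStar P A' t := by
    intro η
    refine tp_mem_SStar_of_forall_req hA' fun q b => ?_
    choose k hk using fun l => (b l).2
    obtain ⟨j, hj⟩ := exists_forall_below k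
    -- The level `j` lies above all nodes named in `k`, so the finite trees eventually treat this
    -- requirement at the node of `η` at level `j`.
    refine ⟨fun l => ⟨_, .wit (trunc η j) q k l, rfl⟩, ?_⟩
    rintro ⟨z, hz, hψ⟩
    choose f hf using fun l => exists_cls_eq (U := U) (z l)
    obtain rfl : (fun l => cls U (f l)) = z := funext hf
    have hr : ∀ (f : Fin q.1 → I → N), q.2.2.Realize (Sum.elim (fun l => cls U (f l))
        (Sum.elim (fun l => (b l : M)) (e η))) ↔ ∀ᶠ i in U, q.2.2.Realize
          (Sum.elim (fun l => f l i) (Sum.elim (fun l => (val (k l) i : N)) (c i η))) := by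
      intro f
      refine Iff.trans (iff_of_eq (congrArg _ (funext ?_))) ((realize_cls q.2.2 (Sum.elim f
        (Sum.elim (fun l i => (val (k l) i : N)) fun l i => c i η l))).trans
        (Filter.eventually_congr (Filter.Eventually.of_forall fun i =>
          iff_of_eq (congrArg _ (funext ?_)))))
      · rintro (l | l | l)
        exacts [rfl, (hk l).symm, rfl]
      · rintro (l | l | l) <;> rfl
    have hev : ∀ᶠ i in U, (∀ l, (val (.wit (trunc η j) q k l) i : N) ∈ predSet P N) ∧
        q.2.2.Realize (Sum.elim (fun l => (val (.wit (trunc η j) q k l) i : N))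
          (Sum.elim (fun l => (val (k l) i : N)) (c i η))) := by
      filter_upwards [hU ⟨{⟨q, k⟩}, {j}⟩, (hr f).1 hψ,
        Filter.eventually_all.2 fun l => cls_mem_predSet.1 (hz l)] with i hi h1 h2
      exact hYR i j (hi.2 (Finset.mem_singleton_self _)) η ⟨q, k⟩
        (hi.1 (Finset.mem_singleton_self _)) hj (c i η) (hc i η) ⟨_, h2, h1⟩
    exact ⟨fun l => cls_mem_predSet.2 (hev.mono fun i hi => hi.1 l),
      (hr _).2 (hev.mono fun i hi => hi.2)⟩
  have hinj : Function.Injective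
      fun η => (⟨t, ⟨tp (Subtype.val : A' → M) (e η), hS η⟩⟩ : Σ n, SStar P A' n) := by
    intro η η' h
    have htp : tp (L := L) (Subtype.val : A' → M) (e η) = tp Subtype.val (e η') := by
      simpa using h
    have hφ : ∀ η j l, trunc η j = l → (φ.Realize (Sum.elim (e η) fun n =>
        cls U fun i => (val (.node l n) i : N)) ↔ η j = true) := by
      rintro η j _ rfl
      rw [realize_cls_elim, ← Filter.eventually_const (f := (U : Filter I)) (p := η j = true)]
      refine Filter.eventually_congr ?_
      filter_upwards [hU ⟨∅, {j}⟩] with i hi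
      exact hYφ i j (hi.2 (Finset.mem_singleton_self _)) η (c i η) (hc i η)
    -- Branches that agree below `j` share the node at level `j` and hence its instance of φ, whose
    -- truth value is read off the common type.
    have hall : ∀ j, η j = η' j := fun j => by
      induction j using WellFoundedLT.induction with
      | ind j ih =>
        rw [Bool.eq_iff_iff, ← hφ η j _ rfl, ← hφ η' j _ (trunc_congr ih).symm]
        let b : Fin m → A' := fun n => ⟨_, .node (trunc η j) n, rfl⟩
        have hmem : ∀ η, φ.Realize (Sum.elim (e η) fun n => (b n : M)) ↔
            φ.relabel (Sum.elim Sum.inr fun n => Sum.inl (b n)) ∈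
              tp (L := L) (Subtype.val : A' → M) (e η) := fun η => by
          refine Iff.trans (iff_of_eq (congrArg _ (funext ?_))) Formula.realize_relabel.symm
          rintro (l | l) <;> rfl
        exact (hmem η).trans ((iff_of_eq (by rw [htp])).trans (hmem η').symm)
    exact funext hall
  have hcard := (mk_le_of_injective hinj).trans
    (hst.2 (Theory.ModelType.of T M) A' heq)
  have h1 : #A' ≤ 2 ^ (ℵ₀ : Cardinal.{max u v}) := mk_range_le.trans (WitTerm.mk_le hL hnode)
  have h2 : theoryCard L = ℵ₀ := max_eq_left hL
  refine hbranch.not_ge ?_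
  calc (2 : Cardinal.{max u v}) ^ #Λ = #(Λ → Bool) := by simp
    _ ≤ #A' ^ theoryCard L := hcard
    _ ≤ (2 ^ (ℵ₀ : Cardinal.{max u v})) ^ (ℵ₀ : Cardinal.{max u v}) := by
      rw [h2]; exact power_le_power_right h1
    _ = _ := by rw [← power_mul, aleph0_mul_aleph0]

end Density

/-! ### Adding an element with locally isolated type -/

section LocallyDetermined

variable {L : FirstOrder.Language.{u, v}} {N : Type w} [L.Structure N]

theorem definable_preimage {B : Set N} {β γ : Type*} {D : Set (γ → N)} (hD : B.Definable L D)
    (f : (β → N) → γ → N)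
    (hf : ∀ c, (∃ b ∈ B, ∀ e, f e c = b) ∨ ∃ j, ∀ e, f e c = e j) :
    B.Definable L {e : β → N | f e ∈ D} := by
  obtain ⟨χ, rfl⟩ := Set.definable_iff_exists_formula_sum.1 hD
  refine definable_setOf_realize χ (fun e => Sum.elim (Subtype.val : B → N) (f e)) ?_
  rintro (b | c)
  exacts [Or.inl ⟨b, b.2, fun _ => rfl⟩, hf c]

/-- All instances of `φ` over `B` are constant on the set `Y`. -/
def Decides (B : Set N) {t m : ℕ} (Y : Set (Fin t → N)) (φ : L.Formula (Fin t ⊕ Fin m)) : Prop :=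
  ∀ y : Fin m → N, (∀ i, y i ∈ B) → ∀ e ∈ Y, ∀ e' ∈ Y,
    φ.Realize (Sum.elim e y) → φ.Realize (Sum.elim e' y)

variable (L) in
/-- The element `d` has a locally isolated type over `B`. -/
def LocallyDetermined (B : Set N) (d : N) : Prop :=
  ∀ (m : ℕ) (φ : L.Formula (Fin 1 ⊕ Fin m)), ∃ X : Set (Fin 1 → N),
    B.Definable L X ∧ (fun _ => d) ∈ X ∧ Decides B X φ

variable {P : L.Relations 1} {B : Set N}

/-- Take `X` ∋ d deciding x = y for all y in B. By completeness `X` contains some a in P ∩ B; since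
a = a, deciding forces d = a. -/
theorem LocallyDetermined.mem_of_mem_predSet {d : N} (hd : LocallyDetermined L B d)
    (hB : IsCompleteSet P B) (hdP : d ∈ predSet P N) : d ∈ B := by
  obtain ⟨X, hXB, hdX, hX⟩ := hd 1 ((Term.var (Sum.inl 0)).equal (Term.var (Sum.inr 0)))
  obtain ⟨a, ha, haX⟩ := hB.exists_mem_of_definable hXB (fun _ => hdP) hdX
  have := hX a (fun i => (ha i).2) a haX _ hdX (by simp [Formula.realize_equal])
  simp only [Formula.realize_equal, Term.realize_var, Sum.elim_inl, Sum.elim_inr] at this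
  exact this ▸ (ha 0).2

/-- Let `X` ∋ d decide ψ, with d as the object variable and both the witness and the rest of `b` as
parameters. Replacing d by "some x in `X`" leaves a B-definable condition on the witness.
Completeness of B solves it in P ∩ B, and as the parameters now lie in B, the solution also works
for d. -/
theorem LocallyDetermined.isCompleteSet_insert {d : N} (hd : LocallyDetermined L B d)
    (hB : IsCompleteSet P B) (hne : B.Nonempty) : IsCompleteSet P (insert d B) := by
  classical
  intro m n ψ b hb ⟨z, hz, hψ⟩
  let b' : Fin n → N := fun j => if b j ∈ B then b j else hne.some
  have hb' : ∀ j, b' j ∈ B := fun j => by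
    by_cases h : b j ∈ B
    · simp [b', h]
    · simp [b', h, hne.some_mem]
  let φ : L.Formula (Fin 1 ⊕ Fin (m + n)) := ψ.relabel (Sum.elim
    (fun i => Sum.inr (Fin.castAdd n i)) fun j => if b j ∈ B then Sum.inr (Fin.natAdd m j) else Sum.inl 0)
  have hφ : ∀ a : Fin m → N, φ.Realize (Sum.elim (fun _ => d) (Fin.append a b')) ↔
      ψ.Realize (Sum.elim a b) := fun a => by
    rw [Formula.realize_relabel]
    refine iff_of_eq (congrArg _ (funext ?_))
    rintro (i | j)
    · simp
    · by_cases h : b j ∈ B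
      · simp [h, b']
      · simpa [h] using ((hb j).resolve_right h).symm
  obtain ⟨X, hXB, hdX, hX⟩ := hd _ φ
  have hD : B.Definable L {a : Fin m → N | ∃ x : Fin 1 → N, Sum.elim a x ∈
      {g : Fin m ⊕ Fin 1 → N | (fun i => g (Sum.inr i)) ∈ X ∧
        φ.Realize (Sum.elim (fun i => g (Sum.inr i))
          (Fin.append (fun i => g (Sum.inl i)) b'))}} := by
    refine Set.Definable.exists_of_finite ((hXB.preimage_comp Sum.inr).inter ?_)
    refine definable_setOf_realize φ _ ?_
    rintro (i | i)
    · exact Or.inr ⟨_, fun _ => rfl⟩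
    · refine Fin.addCases (fun i => ?_) (fun j => ?_) i
      · exact Or.inr ⟨Sum.inl i, fun e => by simp⟩
      · exact Or.inl ⟨b' j, hb' j, fun e => by simp⟩
  obtain ⟨a, ha, x, hxX, hx⟩ := hB.exists_mem_of_definable hD hz ⟨fun _ => d, hdX, (hφ z).2 hψ⟩
  refine ⟨a, fun i => ⟨(ha i).1, Or.inr (ha i).2⟩, (hφ a).1 (hX _ ?_ _ hxX _ hdX hx)⟩
  refine Fin.addCases (fun i => ?_) fun j => ?_
  · simpa using (ha i).2
  · simpa using hb' j

end LocallyDetermined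

/-! ### Density for instances over A ∪ d -/

section Density

variable {L : FirstOrder.Language.{u, v}} [L.IsRelational]

/-- A parameter tuple from A ∪ d has one of finitely many patterns, recording which coordinates are
which entries of d. For a fixed pattern, apply density over A to the tuples (d, x), so that entries
of d become object variables. Constancy passes to subsets, so the patterns can be treated one after
another. -/
theorem StableOver.exists_subset_decides (hL : L.card ≤ ℵ₀) {T : L.Theory}
    {P : L.Relations 1} {N : Type (max u v)} [L.Structure N] [Nonempty N] (hN : N ⊨ T) {A : Set N}
    (hst : StableOver T P A) (hA : A.Nonempty) {n : ℕ} {d : Fin n → N}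
    (hB : IsCompleteSet P (A ∪ Set.range d)) (hPA : predSet P N ∩ (A ∪ Set.range d) ⊆ A)
    {X : Set (Fin 1 → N)} (hX : X.Nonempty) (hXB : (A ∪ Set.range d).Definable L X) {m : ℕ}
    (φ : L.Formula (Fin 1 ⊕ Fin m)) :
    ∃ Y ⊆ X, Y.Nonempty ∧ (A ∪ Set.range d).Definable L Y ∧ Decides (A ∪ Set.range d) Y φ := by
  classical
  set B := A ∪ Set.range d with hBdef
  let par : (Fin m → Option (Fin n)) → (Fin m → A) → Fin m → N :=
    fun σ y j => (σ j).elim (y j : N) d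
  have hone : ∀ (σ : Fin m → Option (Fin n)) (X : Set (Fin 1 → N)), X.Nonempty →
      B.Definable L X → ∃ Y ⊆ X, Y.Nonempty ∧ B.Definable L Y ∧ ∀ y : Fin m → A, ∀ e ∈ Y,
        ∀ e' ∈ Y, φ.Realize (Sum.elim e (par σ y)) → φ.Realize (Sum.elim e' (par σ y)) := by
    intro σ X hX hXB
    let f : (Fin 1 → N) → Fin (n + 1) → N := fun x => Fin.snoc d (x 0)
    have hf : ∀ c, (∃ b ∈ B, ∀ e, f e c = b) ∨ ∃ j, ∀ e, f e c = e j := by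
      refine Fin.lastCases (Or.inr ⟨0, fun e => by simp [f]⟩) fun i => Or.inl ⟨d i, ?_, fun e => ?_⟩
      · exact Or.inr ⟨i, rfl⟩
      · simp [f]
    let Z : Set (Fin (n + 1) → N) := {e | ∀ i : Fin n, e i.castSucc = d i} ∩
      {e | (fun _ => e (Fin.last n)) ∈ X}
    have hZB : B.Definable L Z := by
      refine Set.Definable.inter ?_
        (definable_preimage hXB _ fun _ => Or.inr ⟨Fin.last n, fun _ => rfl⟩)
      have : {e : Fin (n + 1) → N | ∀ i : Fin n, e i.castSucc = d i} =
          ⋂ i : Fin n, {e | e i.castSucc = d i} := by ext e; simp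
      rw [this]
      refine Set.definable_iInter_of_finite fun i => ?_
      have := definable_setOf_realize (L := L) (B := B)
        ((Term.var 0).equal (Term.var 1) : L.Formula (Fin 2))
        (fun e : Fin (n + 1) → N => ![e i.castSucc, d i]) (Fin.forall_fin_two.2
          ⟨Or.inr ⟨_, fun _ => rfl⟩, Or.inl ⟨d i, Or.inr ⟨i, rfl⟩, fun _ => rfl⟩⟩)
      simpa [Formula.realize_equal] using this
    have hfZ : ∀ x, f x ∈ Z ↔ x ∈ X := fun x => by
      have hx : (fun _ : Fin 1 => x 0) = x := funext fun i => by rw [Subsingleton.elim i 0]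
      simp [f, Z, hx]
    have hZf : ∀ e ∈ Z, f (fun _ => e (Fin.last n)) = e := fun e he => by
      ext i
      refine Fin.lastCases ?_ (fun i => ?_) i
      · simp [f]
      · simpa [f] using (he.1 i).symm
    obtain ⟨x, hx⟩ := hX
    obtain ⟨Y, hYZ, ⟨e, he⟩, hYB, hY⟩ := hst.exists_subset_forall_realize_iff hL hN hA hB
      Set.subset_union_left hPA ⟨f x, (hfZ x).2 hx⟩ hZB
      (φ.relabel (Sum.elim (fun _ => Sum.inl (Fin.last n))
        fun j => (σ j).elim (Sum.inr j) fun i => Sum.inl i.castSucc))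
    have hr : ∀ (x : Fin 1 → N) (y : Fin m → A), Formula.Realize (φ.relabel
        (Sum.elim (fun _ => Sum.inl (Fin.last n))
          fun j => (σ j).elim (Sum.inr j) fun i => Sum.inl i.castSucc))
        (Sum.elim (f x) fun i => (y i : N)) ↔ φ.Realize (Sum.elim x (par σ y)) := by
      intro x y
      rw [Formula.realize_relabel]
      refine iff_of_eq (congrArg _ (funext ?_))
      rintro (i | j)
      · simp [f, Subsingleton.elim i 0]
      · rcases h : σ j with _ | i <;> simp [h, par, f]
    refine ⟨{x | f x ∈ Y}, fun x hx => (hfZ x).1 (hYZ hx), ⟨fun _ => e (Fin.last n), ?_⟩,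
      definable_preimage hYB f hf, fun y x hx x' hx' h => (hr x' y).1
        (hY y _ hx _ hx' ((hr x y).2 h))⟩
    rw [Set.mem_ofPred_eq, hZf e (hYZ he)]
    exact he
  have hall : ∀ S : Finset (Fin m → Option (Fin n)), ∃ Y ⊆ X, Y.Nonempty ∧ B.Definable L Y ∧
      ∀ σ ∈ S, ∀ y : Fin m → A, ∀ e ∈ Y, ∀ e' ∈ Y,
        φ.Realize (Sum.elim e (par σ y)) → φ.Realize (Sum.elim e' (par σ y)) := by
    intro S
    induction S using Finset.induction_on with
    | empty => exact ⟨X, subset_rfl, hX, hXB, by simp⟩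
    | insert σ S _ ih =>
      obtain ⟨Y, hYX, hY, hYB, hYS⟩ := ih
      obtain ⟨Z, hZY, hZ, hZB, hZσ⟩ := hone σ Y hY hYB
      refine ⟨Z, hZY.trans hYX, hZ, hZB, fun τ hτ y e he e' he' => ?_⟩
      obtain rfl | hτ := Finset.mem_insert.1 hτ
      · exact hZσ y e he e' he'
      · exact hYS τ hτ y e (hZY he) e' (hZY he')
  obtain ⟨Y, hYX, hY, hYB, hYall⟩ := hall Finset.univ
  refine ⟨Y, hYX, hY, hYB, fun y hy => ?_⟩
  have hσ : ∀ j, ∃ (o : Option (Fin n)) (a : A), o.elim (a : N) d = y j := fun j =>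
    (hy j).elim (fun h => ⟨none, ⟨y j, h⟩, rfl⟩)
      fun ⟨i, hi⟩ => ⟨some i, ⟨hA.some, hA.some_mem⟩, hi⟩
  choose σ a ha using hσ
  obtain rfl : par σ a = y := funext ha
  exact hYall σ (Finset.mem_univ _) a

end Density

/-! ### Countable saturation of ultrapowers and transfer of stability -/

section Saturation

variable {L : FirstOrder.Language.{u, v}}

variable (L) in
/-- Decreasing sequences of nonempty definable sets have nonempty intersection. -/
def CountablySaturated (N : Type*) [L.Structure N] : Prop :=
  ∀ X : ℕ → Set (Fin 1 → N), Antitone X → (∀ n, (X n).Nonempty) →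
    (∀ n, (Set.univ : Set N).Definable L (X n)) → (⋂ n, X n).Nonempty

theorem countablySaturated_ultrapower {N : Type*} [L.Structure N] [Nonempty N]
    {U : Ultrafilter ℕ} (hU : (U : Filter ℕ) ≤ Filter.atTop) :
    CountablySaturated L (Ultrapower U N) := by
  classical
  intro X hX hne hdef
  have hS : ∀ n, ∃ S : ℕ → Set (Fin 1 → N), ∀ f : Fin 1 → ℕ → N,
      (fun j => cls U (f j)) ∈ X n ↔ ∀ᶠ i in U, (fun j => f j i) ∈ S i := by
    intro n
    obtain ⟨r, ψ, b, -, hb⟩ := exists_formula_fin_of_definable (hdef n)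
    choose g hg using fun j => exists_cls_eq (b j)
    obtain rfl : (fun j => cls U (g j)) = b := funext hg
    refine ⟨fun i => {x | ψ.Realize (Sum.elim x fun j => g j i)}, fun f => ?_⟩
    rw [hb]
    exact realize_cls_elim ψ f g
  choose S hS using hS
  have hev : ∀ n, ∀ᶠ i in U, ∃ x, ∀ k ≤ n, x ∈ S k i := by
    intro n
    obtain ⟨x, hx⟩ := hne n
    choose f hf using fun j => exists_cls_eq (x j)
    obtain rfl : (fun j => cls U (f j)) = x := funext hf
    have : ∀ᶠ i in U, ∀ k ∈ Set.Iic n, (fun j => f j i) ∈ S k i :=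
      (Filter.eventually_all_finite (Set.finite_Iic n)).2 fun k hk => (hS k f).1 (hX hk hx)
    exact this.mono fun i hi => ⟨_, hi⟩
  -- At index `i`, meet the longest initial segment of conditions, up to `i`, that has a common
  -- solution.
  have hx : ∀ i, ∃ x : Fin 1 → N, ∀ n ≤ i, (∃ x, ∀ k ≤ n, x ∈ S k i) → x ∈ S n i := by
    intro i
    by_cases h0 : ∃ x, ∀ k ≤ 0, x ∈ S k i
    · obtain ⟨x, hx⟩ := Nat.findGreatest_spec (P := fun n => ∃ x, ∀ k ≤ n, x ∈ S k i)
        (Nat.zero_le i) h0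
      exact ⟨x, fun n hn h => hx n (Nat.le_findGreatest hn h)⟩
    · exact ⟨Classical.arbitrary _, fun n _ ⟨x, hx⟩ =>
        (h0 ⟨x, fun k hk => hx k (hk.trans n.zero_le)⟩).elim⟩
  choose x hx using hx
  refine ⟨fun j => cls U fun i => x i j, Set.mem_iInter.2 fun n => (hS n _).2 ?_⟩
  filter_upwards [hev n, hU (Filter.eventually_ge_atTop n)] with i h1 h2
  exact hx i n h2 h1

variable (L) in
/-- The diagonal embedding into the ultrapower. -/
def diagonal {I : Type*} (U : Ultrafilter I) (N : Type*) [L.Structure N] [Nonempty N] :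
    N ↪ₑ[L] Ultrapower U N where
  toFun a := cls U fun _ => a
  map_formula' _ φ x := (realize_cls φ fun j _ => x j).trans Filter.eventually_const

/-- Completeness is checked at a single good index and the witness found there is embedded
diagonally. The bound on S_* carries over because the diagonal image is elementarily equivalent to
A. -/
theorem StableOver.image_diagonal [L.IsRelational] {T : L.Theory} {P : L.Relations 1}
    {N : Type (max u v)} [L.Structure N] [Nonempty N] {A : Set N} (hA : StableOver T P A)
    (hne : A.Nonempty) {I : Type} (U : Ultrafilter I) : StableOver T P (diagonal L U N '' A) := by
  refine ⟨?_, ?_⟩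
  · intro m n ψ b hb ⟨z, hz, hψ⟩
    choose b' hb' hbb using hb
    choose f hf using fun j => exists_cls_eq (z j)
    obtain rfl : (fun j => cls U (f j)) = z := funext hf
    obtain rfl : (fun j => cls U fun _ => b' j) = b := funext hbb
    obtain ⟨i, hi, hi'⟩ := (((realize_cls_elim ψ f _).1 hψ).and
      (Filter.eventually_all.2 fun j => cls_mem_predSet.1 (hz j))).exists
    obtain ⟨a, ha, hψa⟩ := hA.1 m n ψ b' hb' ⟨_, hi', hi⟩
    exact ⟨fun j => cls U fun _ => a j, fun j => ⟨cls_mem_predSet.2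
      (Filter.Eventually.of_forall fun _ => (ha j).1), a j, (ha j).2, rfl⟩,
      (realize_cls_elim ψ (fun j _ => a j) _).2 (Filter.Eventually.of_forall fun _ => hψa)⟩
  · intro M' A' h
    have hA' : diagonal L U N '' A =
        Set.range fun a : setSub (L := L) A => cls U fun _ => (a : N) := by
      ext x
      exact ⟨fun ⟨a, ha, hx⟩ => ⟨⟨a, ha⟩, hx⟩, fun ⟨a, hx⟩ => ⟨a, a.2, hx⟩⟩
    rw [hA'] at h
    refine hA.2 M' A' (h.trans (elementarilyEquivalent_range_cls (fun a _ => a) fun r φ k => ?_))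
    by_cases hk : ∃ a, φ.Realize default (Fin.snoc k a)
    · exact ⟨hk.choose, fun _ _ => hk.choose_spec⟩
    · exact ⟨⟨hne.some, hne.some_mem⟩, fun _ h => (hk h).elim⟩

end Saturation

/-! ### The construction in ω steps -/

section Construction

variable {L : FirstOrder.Language.{u, v}} [L.IsRelational]

/-- Over a complete set `A ∪ d`, where `A` is countable and stable over `P`, elements with locally
isolated types are dense. -/
theorem StableOver.exists_locallyDetermined (hL : L.card ≤ ℵ₀) {T : L.Theory}
    {P : L.Relations 1} {N : Type (max u v)} [L.Structure N] [Nonempty N] (hN : N ⊨ T)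
    (hsat : CountablySaturated L N) {A : Set N}
    (hst : StableOver T P A) (hA : A.Nonempty) {n : ℕ} {d : Fin n → N}
    (hB : IsCompleteSet P (A ∪ Set.range d)) (hPA : predSet P N ∩ (A ∪ Set.range d) ⊆ A)
    {X : Set (Fin 1 → N)} (hX : X.Nonempty) (hXB : (A ∪ Set.range d).Definable L X) :
    ∃ c : N, (fun _ => c) ∈ X ∧ LocallyDetermined L (A ∪ Set.range d) c := by
  have hc : Countable L.Symbols := mk_le_aleph0_iff.1 hL
  set B := A ∪ Set.range d
  obtain ⟨φ, hφ⟩ := exists_surjective_nat (Σ m : ℕ, L.Formula (Fin 1 ⊕ Fin m))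
  let D := {Y : Set (Fin 1 → N) // Y.Nonempty ∧ B.Definable L Y}
  have hstep : ∀ (n : ℕ) (Y : D), ∃ Z : D, Z.1 ⊆ Y.1 ∧ Decides B Z.1 (φ n).2 := fun n Y =>
    let ⟨Z, hZY, hZ, hZB, h⟩ :=
      hst.exists_subset_decides hL hN hA hB hPA Y.2.1 Y.2.2 (φ n).2
    ⟨⟨Z, hZ, hZB⟩, hZY, h⟩
  choose f hfs hfd using hstep
  -- Stage n + 1 decides the n-th formula, so a point of the intersection is locally determined.
  let Y : ℕ → D := fun n => Nat.rec ⟨X, hX, hXB⟩ (fun n Y => f n Y) n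
  obtain ⟨c, hc⟩ := hsat (fun n => (Y n).1) (antitone_nat_of_succ_le fun n => hfs n (Y n))
    (fun n => (Y n).2.1) fun n => (Y n).2.2.mono (Set.subset_univ _)
  have hc0 : (fun _ => c 0) = c := funext fun i => by rw [Subsingleton.elim i 0]
  rw [Set.mem_iInter, ← hc0] at hc
  refine ⟨c 0, hc 0, fun m ψ => ?_⟩
  obtain ⟨n, hn⟩ := hφ ⟨m, ψ⟩
  have := hfd n (Y n)
  rw [hn] at this
  exact ⟨(Y (n + 1)).1, (Y (n + 1)).2.2, hc (n + 1), this⟩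

/-- Dependent choice with a relation on the previously chosen values. -/
theorem exists_seq_of_forall_exists {α : Type*} [Nonempty α] (R : ℕ → (ℕ → α) → α → Prop)
    (hR : ∀ n d d' x, (∀ k < n, d k = d' k) → R n d x → R n d' x)
    (hstep : ∀ n d, (∀ k < n, R k d (d k)) → ∃ x, R n d x) : ∃ d : ℕ → α, ∀ n, R n d (d n) := by
  classical
  have hf : ∀ n d, ∃ x, (∃ x, R n d x) → R n d x := fun n d => by
    by_cases h : ∃ x, R n d x
    · exact ⟨h.choose, fun _ => h.choose_spec⟩
    · exact ⟨Classical.arbitrary α, fun h' => (h h').elim⟩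
  choose f hf using hf
  let g : ℕ → ℕ → α := fun n =>
    Nat.rec (fun _ => Classical.arbitrary α) (fun n d => Function.update d n (f n d)) n
  have hg : ∀ n k, k < n → g n k = g (k + 1) k := by
    intro n k h
    induction n, h using Nat.le_induction with
    | base => rfl
    | succ n h ih => exact (Function.update_of_ne (Nat.ne_of_lt h) _ _).trans ih
  have hgs : ∀ n, g (n + 1) n = f n (g n) := fun n => Function.update_self ..
  refine ⟨fun n => g (n + 1) n, fun n => ?_⟩
  induction n using Nat.strong_induction_on with
  | _ n ih =>
    have h1 : ∃ x, R n (g n) x := hstep n _ fun k hk => by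
      rw [hg n k hk]
      exact hR k _ _ _ (fun l hl => (hg n l (hl.trans hk)).symm) (ih k hk)
    have h2 := hf n _ h1
    rw [← hgs] at h2
    exact hR n _ _ _ (fun k hk => hg n k hk) h2

theorem union_image_Iio_succ {α : Type*} (A : Set α) (d : ℕ → α) (n : ℕ) :
    A ∪ d '' Set.Iio (n + 1) = insert (d n) (A ∪ d '' Set.Iio n) := by
  rw [← Set.union_insert, ← Set.image_insert_eq]
  congr 2
  ext k
  simp [le_iff_eq_or_lt]

theorem union_image_Iio_eq_union_range {α : Type*} (A : Set α) (d : ℕ → α) (n : ℕ) :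
    A ∪ d '' Set.Iio n = A ∪ Set.range fun i : Fin n => d i := by
  congr 1
  ext x
  exact ⟨fun ⟨k, hk, h⟩ => ⟨⟨k, hk⟩, h⟩, fun ⟨k, h⟩ => ⟨k, k.2, h⟩⟩

theorem isCompleteSet_union_image_Iio {L : FirstOrder.Language.{u, v}} {P : L.Relations 1}
    {N : Type*} [L.Structure N] {A : Set N}
    (hA : IsCompleteSet P A) (hne : A.Nonempty) {d : ℕ → N} {n : ℕ}
    (hd : ∀ k < n, LocallyDetermined L (A ∪ d '' Set.Iio k) (d k)) :
    IsCompleteSet P (A ∪ d '' Set.Iio n) ∧ predSet P N ∩ (A ∪ d '' Set.Iio n) ⊆ A := by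
  induction n with
  | zero => simp [hA]
  | succ n ih =>
    obtain ⟨h1, h2⟩ := ih fun k hk => hd k (hk.trans n.lt_succ_self)
    have hdn := hd n n.lt_succ_self
    rw [union_image_Iio_succ]
    refine ⟨hdn.isCompleteSet_insert h1 (hne.mono Set.subset_union_left), ?_⟩
    rintro x ⟨hxP, rfl | hx⟩
    · exact h2 ⟨hxP, hdn.mem_of_mem_predSet h1 hxP⟩
    · exact h2 ⟨hxP, hx⟩

/-- A countable set that is stable over `P` in a countably saturated model extends to an elementary
submodel by a sequence of elements with locally isolated types. -/
theorem StableOver.exists_elementarySubstructure (hL : L.card ≤ ℵ₀) {T : L.Theory}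
    {P : L.Relations 1} {N : Type (max u v)} [L.Structure N] [Nonempty N] (hN : N ⊨ T)
    (hsat : CountablySaturated L N) {A : Set N} (hst : StableOver T P A) (hA : A.Nonempty)
    (hcA : A.Countable) : ∃ (d : ℕ → N) (S : L.ElementarySubstructure N),
      (∀ n, LocallyDetermined L (A ∪ d '' Set.Iio n) (d n)) ∧ (S : Set N) = A ∪ Set.range d ∧
        predSet P N ∩ (A ∪ Set.range d) ⊆ A := by
  classical
  have hc : Countable L.Symbols := mk_le_aleph0_iff.1 hL
  have hcA' : Countable A := hcA.to_subtype
  let Code := Σ r : ℕ, L.Formula (Fin 1 ⊕ Fin r) × (Fin r → A ⊕ ℕ)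
  have : Nonempty Code := ⟨⟨0, ⊥, Fin.elim0⟩⟩
  obtain ⟨code, hcode⟩ := exists_surjective_nat Code
  let ev : (ℕ → N) → A ⊕ ℕ → N := fun d => Sum.elim Subtype.val d
  let Sol : (ℕ → N) → Code → N → Prop := fun d c x =>
    c.2.1.Realize (Sum.elim (fun _ => x) fun j => ev d (c.2.2 j))
  let InRange : ℕ → Code → Prop := fun n c => ∀ j k, c.2.2 j = Sum.inr k → k < n
  have hev : ∀ n d d' c x, InRange n c → (∀ k < n, d k = d' k) → (Sol d c x ↔ Sol d' c x) := by
    intro n d d' c x hc h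
    refine iff_of_eq (congrArg (fun y => c.2.1.Realize (Sum.elim (fun _ => x) y))
      (funext fun j => ?_))
    rcases hj : c.2.2 j with a | k
    · rfl
    · exact h k (hc j k hj)
  -- Stage `n` attends to the code given by the first component of `n`, so each code recurs at
  -- arbitrarily late stages. It is solved once all its parameters have been constructed, if it has
  -- a solution.
  obtain ⟨d, hd⟩ := exists_seq_of_forall_exists
    (fun n d x => LocallyDetermined L (A ∪ d '' Set.Iio n) x ∧
      (InRange n (code n.unpair.1) → (∃ x, Sol d (code n.unpair.1) x) →
        Sol d (code n.unpair.1) x)) (by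
      rintro n d d' x h ⟨h1, h2⟩
      have himg : d '' Set.Iio n = d' '' Set.Iio n := Set.image_congr h
      refine ⟨himg ▸ h1, fun h3 ⟨x', hx'⟩ => ?_⟩
      exact (hev n d d' _ x h3 h).1 (h2 h3 ⟨x', (hev n d d' _ x' h3 h).2 hx'⟩)) (by
      intro n d h
      obtain ⟨h1, h2⟩ := isCompleteSet_union_image_Iio hst.1 hA fun k hk => (h k hk).1
      rw [union_image_Iio_eq_union_range] at h1 h2 ⊢
      by_cases h3 : InRange n (code n.unpair.1) ∧ ∃ x, Sol d (code n.unpair.1) x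
      · obtain ⟨h3, x, hx⟩ := h3
        obtain ⟨c, hcX, hc⟩ := hst.exists_locallyDetermined hL hN hsat hA h1 h2
          (X := {x | (code n.unpair.1).2.1.Realize
            (Sum.elim x fun j => ev d ((code n.unpair.1).2.2 j))}) ⟨fun _ => x, hx⟩ (by
            refine definable_setOf_realize _ _ ?_
            rintro (i | j)
            · exact Or.inr ⟨i, fun _ => rfl⟩
            · refine Or.inl ⟨_, ?_, fun _ => rfl⟩
              rcases hj : (code n.unpair.1).2.2 j with a | k
              · exact Or.inl a.2
              · exact Or.inr ⟨⟨k, h3 j k hj⟩, rfl⟩)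
        exact ⟨c, hc, fun _ _ => hcX⟩
      · obtain ⟨c, -, hc⟩ := hst.exists_locallyDetermined hL hN hsat hA h1 h2
          (X := Set.univ) ⟨fun _ => hA.some, trivial⟩ Set.definable_univ
        exact ⟨c, hc, fun h4 h5 => (h3 ⟨h4, h5⟩).elim⟩)
  have hPd : predSet P N ∩ (A ∪ Set.range d) ⊆ A := by
    rintro x ⟨hxP, hx | ⟨n, rfl⟩⟩
    · exact hx
    · exact (isCompleteSet_union_image_Iio hst.1 hA (n := n + 1) fun k _ => (hd k).1).2
        ⟨hxP, Or.inr ⟨n, n.lt_succ_self, rfl⟩⟩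
  refine ⟨d, (setSub (L := L) (A ∪ Set.range d)).toElementarySubstructure ?_,
    fun n => (hd n).1, rfl, hPd⟩
  -- The Tarski–Vaught test: the formula with its parameters in A ∪ d has a code.
  intro n φ x a ha
  have hg : ∀ j, ∃ g : A ⊕ ℕ, ev d g = x j := fun j =>
    (x j).2.elim (fun h => ⟨Sum.inl ⟨_, h⟩, rfl⟩) fun ⟨k, hk⟩ => ⟨Sum.inr k, hk⟩
  choose g hg using hg
  obtain ⟨m, hm⟩ := hcode ⟨n, φ.toFormula.relabel (Sum.elim Empty.elim
    (Fin.lastCases (Sum.inl 0) Sum.inr)), g⟩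
  obtain ⟨M, hM⟩ : ∃ M, InRange M (code m) := by
    obtain ⟨M, hM⟩ := (Set.finite_range fun j => Sum.elim (fun _ => 0) id (g j)).bddAbove
    refine ⟨M + 1, ?_⟩
    rw [hm]
    intro j k hj
    have := hM ⟨j, rfl⟩
    simp only at hj
    simpa [hj, Nat.lt_succ_iff] using this
  have hSol : ∀ y, Sol d (code m) y ↔ φ.Realize default (Fin.snoc (Subtype.val ∘ x) y) := by
    intro y
    rw [hm]
    refine Formula.realize_relabel.trans ((iff_of_eq (congrArg _ (funext ?_))).trans
      (BoundedFormula.realize_toFormula φ (Sum.elim default (Fin.snoc (Subtype.val ∘ x) y))))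
    rintro (i | i)
    · exact i.elim
    · refine Fin.lastCases ?_ (fun i => ?_) i
      · simp
      · simp [hg]
  -- Since k ≥ `M`, the parameters of code `m` are all available at stage `k`.
  let k := Nat.pair m M
  have hk : code k.unpair.1 = code m := by simp [k]
  have hkM : InRange k (code m) := fun j l h =>
    (hM j l h).trans_le (Nat.right_le_pair m M)
  have h1 := (hd k).2
  rw [hk] at h1
  exact ⟨⟨d k, Or.inr ⟨k, rfl⟩⟩, (hSol _).1 (h1 hkM ⟨a, (hSol a).2 ha⟩)⟩

end Construction

/-! ### From definable sets in N to local isolation in the submodel -/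

section Transfer

variable {L : FirstOrder.Language.{u, v}} {N : Type w} [L.Structure N]

/-- An element of an elementary submodel with a locally isolated type over a subset of that
submodel has a locally isolated type there. -/
theorem LocallyDetermined.locallyIsolated (S : L.ElementarySubstructure N) {B : Set N}
    {B' : Set S} (hB : Subtype.val '' B' = B) {d : S} (hd : LocallyDetermined L B (d : N)) :
    LocallyIsolated (tp (L := L) (Subtype.val : B' → S) fun _ : Fin 1 => d) := by
  intro m φ
  obtain ⟨X, hXB, hdX, hX⟩ := hd m φ
  obtain ⟨χ, rfl⟩ := Set.definable_iff_exists_formula_sum.1 hXB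
  have hg : ∀ b : B, ∃ b' : B', ((b' : S) : N) = b := fun ⟨b, hb⟩ => by
    obtain ⟨b', hb', rfl⟩ := hB.symm.subset hb
    exact ⟨⟨b', hb'⟩, rfl⟩
  choose g hg using hg
  have hχ : ∀ x : Fin 1 → S, (χ.relabel (Sum.map g id)).Realize
      (Sum.elim (Subtype.val : B' → S) x) ↔ (fun i => (x i : N)) ∈
        {v | χ.Realize (Sum.elim (Subtype.val : B → N) v)} := by
    intro x
    rw [Formula.realize_relabel, ← S.subtype.map_formula]
    refine iff_of_eq (congrArg _ (funext ?_))
    rintro (b | i)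
    exacts [hg b, rfl]
  refine ⟨χ.relabel (Sum.map g id), (hχ _).2 hdX, fun x hx ψ hψ => ?_⟩
  have hinst : ∀ (b : Fin m → B') (x : Fin 1 → S), (inst φ b).Realize
      (Sum.elim (Subtype.val : B' → S) x) ↔
        φ.Realize (Sum.elim (fun i => (x i : N)) fun i => ((b i : S) : N)) := by
    intro b x
    rw [inst, Formula.realize_relabel, ← S.subtype.map_formula]
    refine iff_of_eq (congrArg _ (funext ?_))
    rintro (i | i) <;> rfl
  have hbB : ∀ (b : Fin m → B') i, ((b i : S) : N) ∈ B := fun b i =>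
    hB.subset ⟨b i, (b i).2, rfl⟩
  obtain ⟨hd', b, rfl | rfl⟩ := hψ
  · exact (hinst b x).2 (hX _ (hbB b) _ hdX _ ((hχ x).1 hx) ((hinst b _).1 hd'))
  -- The negated case uses constancy in the reverse direction, from `x` to `d`.
  · exact fun h => hd' ((hinst b _).2 (hX _ (hbB b) _ ((hχ x).1 hx) _ hdX ((hinst b x).1 h)))

theorem locallyConstructible_of_locallyDetermined {P : L.Relations 1}
    (S : L.ElementarySubstructure N) {A : Set N} {d : ℕ → N}
    (hd : ∀ n, LocallyDetermined L (A ∪ d '' Set.Iio n) (d n))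
    (hS : (S : Set N) = A ∪ Set.range d) (hP : predSet P N ∩ (A ∪ Set.range d) ⊆ A) :
    LocallyConstructible P ((Subtype.val : S → N) ⁻¹' A) (Set.univ : Set S) := by
  have hdS : ∀ n, d n ∈ S := fun n => hS.symm.subset (Or.inr ⟨n, rfl⟩)
  refine ⟨fun x hx => hP ⟨?_, hS.subset x.2⟩, Ordinal.omega0, ?_⟩
  · rw [mem_predSet_iff] at hx ⊢
    exact hx
  -- The map `f` identifies the ordinals below ω with ℕ, preserving order, so initial segments of
  -- the two indexings match.
  · choose f hf using fun i : Set.Iio Ordinal.omega0.{w} => Ordinal.lt_omega0.1 i.2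
    have hsurj : ∀ n : ℕ, ∃ i, f i = n := fun n =>
      ⟨⟨n, Ordinal.natCast_lt_omega0 n⟩, Nat.cast_injective (R := Ordinal.{w}) (hf _).symm⟩
    have hlt : ∀ i j, i < j ↔ f i < f j := fun i j => by
      rw [← Subtype.coe_lt_coe, hf i, hf j, Nat.cast_lt]
    refine ⟨fun i => ⟨d (f i), hdS _⟩, fun i => ?_, ?_⟩
    · refine LocallyDetermined.locallyIsolated S ?_ (hd (f i))
      ext x
      constructor
      · rintro ⟨x, hx | ⟨j, hj, rfl⟩, rfl⟩
        · exact Or.inl hx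
        · exact Or.inr ⟨f j, (hlt j i).1 hj, rfl⟩
      · rintro (hx | ⟨n, hn, rfl⟩)
        · exact ⟨⟨x, hS.symm.subset (Or.inl hx)⟩, Or.inl hx, rfl⟩
        · obtain ⟨j, rfl⟩ := hsurj n
          exact ⟨⟨d (f j), hdS _⟩, Or.inr ⟨j, (hlt j i).2 hn, rfl⟩, rfl⟩
    · refine (Set.eq_univ_of_forall fun x => ?_).symm
      obtain hx | ⟨n, hn⟩ := hS.subset x.2
      · exact Or.inl hx
      · obtain ⟨j, rfl⟩ := hsurj n
        exact Or.inr ⟨j, Subtype.ext hn⟩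

end Transfer

end OverP

theorem mainTheorem7 {L : FirstOrder.Language.{u, v}} [L.IsRelational]
    (hL : L.card ≤ ℵ₀) (T : L.Theory) (hT : T.IsComplete) (hQE : OverP.HasQE T)
    (P : L.Relations 1) (hPinf : OverP.PredInfinite T P)
    (hPse : OverP.StablyEmbedded T P) (hPdef : OverP.DefinableInPred T P)
    (N : FirstOrder.Language.Theory.ModelType.{u, v, max u v} T) (A : Set N)
    (hA : A.Countable) (hAstable : OverP.StableOver T P A) :
    OverP.HasLCExistence P A := by
  -- P has a point in `N`, so completeness, applied to a true formula without parameters, yields one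
  -- in A.
  have hne : A.Nonempty := by
    obtain ⟨x, hx⟩ := (hPinf N).nonempty
    obtain ⟨a, ha, -⟩ := hAstable.1 1 0 ⊤ Fin.elim0 (fun i => i.elim0)
      ⟨fun _ => x, fun _ => hx, by simp⟩
    exact ⟨a 0, (ha 0).2⟩
  -- `N` need not be countably saturated, so the construction runs in a nonprincipal ultrapower over
  -- the diagonal copy of A.
  let U : Ultrafilter ℕ := Filter.hyperfilter ℕ
  let C := OverP.Ultrapower U N
  let j : N ↪ₑ[L] C := OverP.diagonal L U N
  have hC : C ⊨ T := ⟨fun χ hχ => (Ultraproduct.sentence_realize χ).2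
    (Filter.Eventually.of_forall fun _ => Theory.realize_sentence_of_mem T hχ)⟩
  obtain ⟨d, S, hd, hS, hP⟩ := (hAstable.image_diagonal hne U).exists_elementarySubstructure hL hC
    (OverP.countablySaturated_ultrapower Nat.hyperfilter_le_atTop) (hne.image j)
    (hA.image j)
  refine ⟨C, inferInstance, j, S, ?_, ?_,
    OverP.locallyConstructible_of_locallyDetermined S hd hS hP⟩
  · rw [hS]
    exact Set.subset_union_left
  · rw [hS]
    exact subset_antisymm (fun x hx => ⟨hx.1, hP hx⟩) fun x hx => ⟨hx.1, Or.inl hx.2⟩
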